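/- A multiring is a commutative monoid $(A,\cdot,1)$ with a constant $0$, a map $-\colon A\to A$ and a multivalued addition $(a,b)\mapsto a+b$ with values non-empty subsets of $A$, such that for all $a,b,c,d,x\in A$: $a\in b+c$ implies $c\in -b+a$ and $b\in a+(-c)$; $a\in b+0$ if and only if $a=b$; if $g\in a+b$ and $x\in g+c$, then $x\in a+h$ for some $h\in b+c$; $a+b=b+a$; $a\cdot 0=0$; $a\in b+c$ implies $ad\in bd+cd$. It is a hyperring if moreover every $x\in bd+cd$ has the form $x=ad$ with $a\in b+c$, and a von Neumann hyperring if it is a hyperring in which every $a$ can be written $a=a^2b$. A multiring is real reduced if $-1\notin\sum A^2$ (no finite sum of squares contains $-1$) and for all $a,b$: $a^3=a$, $a+b^2a=\{a\}$, and $a^2+b^2$ has exactly one element. An ideal is a subset $I\ni 0$ with $I+I\subseteq I$ and $AI\subseteq I$; it is prime if $1\notin I$ and $ab\in I$ implies $a\in I$ or $b\in I$. The set $\mathrm{spec}(A)$ of prime ideals has the topology generated by the sets $D(a)=\{p : a\notin p\}$. For $p\in\mathrm{spec}(A)$ let $K_A(p)=(A/p\setminus\{0\})^{-1}(A/p)$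 be the fraction hyperfield of $A/p$. Here $A/I$ is the quotient of $A$ by the relation $(a-b)\cap I\neq\emptyset$, with $x\in y+z$ in $A/I$ if and only if $x,y,z$ have representatives $a,b,c$ with $a\in b+c$; and in a localization $S^{-1}A$, $a/s=b/t$ if and only if $atu=bsu$ for some $u\in S$, and $a/s\in b/t+c/u$ if and only if $atuv\in bsuv+cstv$ for some $v\in S$. The von Neumann hull $V(A)$ is the set of all $f\in\prod_{p\in\mathrm{spec}(A)}K_A(p)$ such that every $p\in\mathrm{spec}(A)$ has a neighbourhood $U$, clopen in the constructible topology of $\mathrm{spec}(A)$, and $x,y\in A$ with $U\subseteq D(y)$ and $f(q)=x/y$ in $K_A(q)$ for all $q\in U$. Its constants, its product and $-$ are pointwise, and $f\in g+h$ if and only if $f(p)\in g(p)+h(p)$ for all $p$. Let $\mathbf 3=\{1,0,-1\}$ be the sign hyperfield, with the usual product and $0+x=x+0=\{x\}$, $1+1=\{1\}$, $(-1)+(-1)=\{-1\}$, $1+(-1)=(-1)+1=\mathbf 3$. Let $\mathrm{sper}(A)$ be the set of multiring morphisms $A\to\mathbf 3$ (maps preserving $0$, $1$, $-$ and products, and such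 that $a\in b+c$ implies $\sigma(a)\in\sigma(b)+\sigma(c)$). Then $Q(A)$ is the image of $A\to\mathbf 3^{\mathrm{sper}(A)}$, $a\mapsto\hat a=(\sigma\mapsto\sigma(a))$, with the induced product, $-$ and constants, and with $x\in y+z$ in $Q(A)$ if and only if $a\in b+c$ for some $a,b,c\in A$ with $\hat a=x$, $\hat b=y$, $\hat c=z$. A multiring $B$ is geometric if its structural presheaf $\mathcal F(D(a))=S_a^{-1}B$ on the basic open sets of $\mathrm{spec}(B)$ is a sheaf, where $S_a=\{x\in B : a^n \text{ lies in the ideal generated by } x \text{ for some } n\ge 0\}$ and the restriction maps are $x/s\mapsto x/s$. That is, for every cover $D(e)=\bigcup_i D(e_i)$: (1) if $a,b,c\in\mathcal F(D(e))$ satisfy $a\in b+c$ after restriction to each $D(e_i)$, then $a\in b+c$; (2) all families $x_i\in\mathcal F(D(e_i))$ such that $x_i$ and $x_j$ agree in $\mathcal F(D(e_ie_j))$ for all $i,j$ are the restrictions of some $x\in\mathcal F(D(e))$. **Proposition.** Let $A$ be a multiring. 1. If $A$ is a real reduced multiring, then $V(A)$ is a real reduced multiring. 2. If $A$ is a von Neumann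 hyperring, then $Q(A)$ is a geometric von Neumann hyperring. -/

import Mathlib

universe u

set_option linter.unusedSectionVars false

/-- The data of a multiring: a commutative monoid with a constant `0`, a unary `-`, and a
multivalued addition. The axioms are in `Multiring.IsMultiring`. -/
class MultiringStruct (A : Type u) extends CommMonoid A, Zero A, Neg A where
  /-- multivalued addition -/
  hadd : A → A → Set A

infixl:65 " +ₕ " => MultiringStruct.hadd

namespace Multiring

/-- The axioms of a multiring. -/
class IsMultiring (A : Type u) [MultiringStruct A] : Prop where
  add_nonempty : ∀ a b : A, (a +ₕ b).Nonempty
  reversible : ∀ a b c : A, a ∈ b +ₕ c → c ∈ (-b) +ₕ a ∧ b ∈ a +ₕ (-c)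
  mem_add_zero : ∀ a b : A, a ∈ b +ₕ 0 ↔ a = b
  add_assoc : ∀ a b c g x : A, g ∈ a +ₕ b → x ∈ g +ₕ c → ∃ h ∈ b +ₕ c, x ∈ a +ₕ h
  add_comm : ∀ a b : A, a +ₕ b = b +ₕ a
  mul_zero : ∀ a : A, a * 0 = 0
  half_distrib : ∀ a b c d : A, a ∈ b +ₕ c → a * d ∈ b * d +ₕ c * d

/-- A hyperring is a multiring with `bd + cd ⊆ (b + c)d`. -/
class IsHyperring (A : Type u) [MultiringStruct A] : Prop extends IsMultiring A where
  distrib : ∀ b c d x : A, x ∈ b * d +ₕ c * d → ∃ a ∈ b +ₕ c, x = a * d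

/-- The iterated sum `x₁ + (x₂ + (⋯ + xₙ))`, a set (the empty sum is `{0}`). -/
def listSum {A : Type u} [MultiringStruct A] : List A → Set A
  | [] => {0}
  | a :: l => {x | ∃ y ∈ listSum l, x ∈ a +ₕ y}

/-- `∑ A²`: the elements of `a₁² + ⋯ + aₙ²` for some `a₁, …, aₙ`. -/
def sumSq (A : Type u) [MultiringStruct A] : Set A :=
  {x | ∃ l : List A, x ∈ listSum (l.map fun a => a ^ 2)}

/-- `A` is semi-real: `-1 ∉ ∑ A²`. -/
def IsSemireal (A : Type u) [MultiringStruct A] : Prop := (-1 : A) ∉ sumSq A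

/-- Real reduced multirings. -/
structure IsRealReducedMultiring (A : Type u) [MultiringStruct A] : Prop
    extends IsMultiring A where
  semireal : IsSemireal A
  cube : ∀ a : A, a ^ 3 = a
  add_sq_mul : ∀ a b : A, a +ₕ b ^ 2 * a = {a}
  sq_add_sq : ∀ a b : A, ∃! x, x ∈ a ^ 2 +ₕ b ^ 2

/-- Von Neumann (regular) hyperrings. -/
structure IsVonNeumannHyperring (A : Type u) [MultiringStruct A] : Prop
    extends IsHyperring A where
  regular : ∀ a : A, ∃ b : A, a = a ^ 2 * b

/-! ### Elementary consequences of the axioms -/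

section Basic

variable {A : Type u} [MultiringStruct A] [IsMultiring A]

theorem mem_add_comm {a b c : A} (h : a ∈ b +ₕ c) : a ∈ c +ₕ b := by
  rwa [IsMultiring.add_comm]

theorem self_mem_add_zero (a : A) : a ∈ a +ₕ 0 := (IsMultiring.mem_add_zero a a).2 rfl

theorem zero_mem_add_neg (a : A) : (0 : A) ∈ a +ₕ (-a) :=
  mem_add_comm (IsMultiring.reversible _ _ _ (self_mem_add_zero a)).1

theorem eq_neg_of_zero_mem {a b : A} (h : (0 : A) ∈ a +ₕ b) : b = -a :=
  (IsMultiring.mem_add_zero _ _).1 (IsMultiring.reversible _ _ _ h).1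

theorem neg_neg' (a : A) : -(-a) = a :=
  (eq_neg_of_zero_mem (mem_add_comm (zero_mem_add_neg a))).symm

theorem neg_zero' : (-0 : A) = 0 := (eq_neg_of_zero_mem (self_mem_add_zero (0 : A))).symm

theorem zero_mul' (a : A) : 0 * a = 0 := by rw [mul_comm, IsMultiring.mul_zero]

theorem neg_mul' (a b : A) : -a * b = -(a * b) := by
  apply eq_neg_of_zero_mem
  have := IsMultiring.half_distrib _ _ _ b (zero_mem_add_neg a)
  rwa [zero_mul'] at this

theorem neg_mem_add {a b c : A} (h : a ∈ b +ₕ c) : -a ∈ (-b) +ₕ (-c) := by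
  have := IsMultiring.half_distrib _ _ _ (-1) h
  simpa only [mul_comm _ (-1 : A), neg_mul', one_mul] using this

theorem mul_mem_add {a b c a' b' c' : A} (d : A) (h : a ∈ b +ₕ c)
    (ha : a * d = a') (hb : b * d = b') (hc : c * d = c') : a' ∈ b' +ₕ c' := by
  subst ha hb hc
  exact IsMultiring.half_distrib _ _ _ _ h

theorem add_assoc' {a b c h x : A} (hh : h ∈ b +ₕ c) (hx : x ∈ a +ₕ h) :
    ∃ g ∈ a +ₕ b, x ∈ g +ₕ c := by
  obtain ⟨g, hg, hx'⟩ := IsMultiring.add_assoc c b a h x (mem_add_comm hh) (mem_add_comm hx)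
  exact ⟨g, mem_add_comm hg, mem_add_comm hx'⟩

theorem add_add_add_comm' {x p q b i c j : A} (hx : x ∈ p +ₕ q) (hp : p ∈ b +ₕ i)
    (hq : q ∈ c +ₕ j) : ∃ k ∈ b +ₕ c, ∃ l ∈ i +ₕ j, x ∈ k +ₕ l := by
  obtain ⟨h, hh, hx⟩ := IsMultiring.add_assoc _ _ _ _ _ hp hx
  obtain ⟨g, hg, hh⟩ := add_assoc' hq hh
  obtain ⟨m, hm, hh⟩ := IsMultiring.add_assoc _ _ _ _ _ (mem_add_comm hg) hh
  obtain ⟨k, hk, hx⟩ := add_assoc' hh hx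
  exact ⟨k, hk, m, hm, hx⟩

end Basic

/-! ### Ideals and the prime spectrum -/

/-- Ideals of a multiring (nonempty by definition). -/
@[ext]
structure MIdeal (A : Type u) [MultiringStruct A] where
  carrier : Set A
  zero_mem : (0 : A) ∈ carrier
  add_mem : ∀ a ∈ carrier, ∀ b ∈ carrier, a +ₕ b ⊆ carrier
  mul_mem : ∀ a : A, ∀ b ∈ carrier, a * b ∈ carrier

namespace MIdeal

variable {A : Type u} [MultiringStruct A]

instance : Membership A (MIdeal A) := ⟨fun I a => a ∈ I.carrier⟩

/-- Prime ideals. -/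
structure IsPrime (I : MIdeal A) : Prop where
  one_notMem : (1 : A) ∉ I
  mem_or_mem : ∀ a b : A, a * b ∈ I → a ∈ I ∨ b ∈ I

/-- The ideal generated by a set: the intersection of all ideals containing it. -/
def span [IsMultiring A] (X : Set A) : MIdeal A where
  carrier := {a | ∀ I : MIdeal A, X ⊆ I.carrier → a ∈ I}
  zero_mem I _ := I.zero_mem
  add_mem a ha b hb _ hx I hI := I.add_mem a (ha I hI) b (hb I hI) hx
  mul_mem a b hb I hI := I.mul_mem a b (hb I hI)

/-- The ideal quotient `(I : a)`. -/
def colon [IsMultiring A] (I : MIdeal A) (a : A) : MIdeal A where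
  carrier := {z | z * a ∈ I}
  zero_mem := by
    show 0 * a ∈ I
    rw [zero_mul']; exact I.zero_mem
  add_mem x hx y hy z hz := I.add_mem _ hx _ hy (IsMultiring.half_distrib _ _ _ a hz)
  mul_mem x y hy := by
    show x * y * a ∈ I
    rw [mul_assoc]; exact I.mul_mem x _ hy

variable [IsMultiring A]

theorem subset_span (X : Set A) : X ⊆ (span X).carrier := fun _ ha _ hI => hI ha

theorem span_le {X : Set A} {I : MIdeal A} (h : X ⊆ I.carrier) : (span X).carrier ⊆ I.carrier :=
  fun _ ha => ha I h

/-- `XY ⊆ I` implies `(X)(Y) ⊆ I`. -/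
theorem mul_mem_of_span {X Y : Set A} {I : MIdeal A} (h : ∀ x ∈ X, ∀ y ∈ Y, x * y ∈ I)
    {a b : A} (ha : a ∈ span X) (hb : b ∈ span Y) : a * b ∈ I := by
  refine ha (I.colon b) fun x hx => ?_
  have : b * x ∈ I := hb (I.colon x) fun y hy => by
    show y * x ∈ I
    rw [mul_comm]; exact h x hx y hy
  show x * b ∈ I
  rwa [mul_comm]

theorem neg_mem {I : MIdeal A} {a : A} (h : a ∈ I) : -a ∈ I := by
  have := I.mul_mem (-1) a h
  rwa [neg_mul', one_mul] at this

theorem pow_mem_imp {I : MIdeal A} (hI : I.IsPrime) {a : A} (n : ℕ) (h : a ^ n ∈ I) : a ∈ I := by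
  induction n with
  | zero => exact absurd (by simpa using h) hI.one_notMem
  | succ n ih =>
    rw [pow_succ] at h
    exact (hI.mem_or_mem _ _ h).elim ih id

/-- An ideal containing no power of `c` extends to a prime ideal not containing `c`. -/
theorem exists_prime {I : MIdeal A} {c : A} (hI : ∀ n : ℕ, c ^ n ∉ I) :
    ∃ P : MIdeal A, P.IsPrime ∧ I.carrier ⊆ P.carrier ∧ c ∉ P := by
  obtain ⟨M, hIM, hM⟩ := zorn_subset_nonempty
    {s : Set A | ∃ J : MIdeal A, J.carrier = s ∧ ∀ n : ℕ, c ^ n ∉ J}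
    (by
      intro C hC hchain hne
      have key : ∀ a ∈ ⋃₀ C, ∀ b ∈ ⋃₀ C, ∃ J : MIdeal A, J.carrier ∈ C ∧ a ∈ J ∧ b ∈ J := by
        rintro a ⟨s, hs, ha⟩ b ⟨t, ht, hb⟩
        obtain ⟨J, rfl, -⟩ := hC hs
        obtain ⟨K, rfl, -⟩ := hC ht
        rcases hchain.total hs ht with h | h
        · exact ⟨K, ht, h ha, hb⟩
        · exact ⟨J, hs, ha, h hb⟩
      refine ⟨⋃₀ C, ⟨⟨⋃₀ C, ?_, ?_, ?_⟩, rfl, ?_⟩, fun s hs => Set.subset_sUnion_of_mem hs⟩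
      · obtain ⟨s, hs⟩ := hne
        obtain ⟨J, rfl, -⟩ := hC hs
        exact ⟨_, hs, J.zero_mem⟩
      · intro a ha b hb x hx
        obtain ⟨J, hJ, ha, hb⟩ := key a ha b hb
        exact ⟨_, hJ, J.add_mem a ha b hb hx⟩
      · rintro a b ⟨s, hs, hb⟩
        obtain ⟨J, rfl, -⟩ := hC hs
        exact ⟨_, hs, J.mul_mem a b hb⟩
      · rintro n ⟨s, hs, hn⟩
        obtain ⟨J, rfl, hJ⟩ := hC hs
        exact hJ n hn)
    I.carrier ⟨I, rfl, hI⟩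
  obtain ⟨P, rfl, hP⟩ := hM.prop
  have big : ∀ a : A, a ∉ P → ∃ n : ℕ, c ^ n ∈ span (P.carrier ∪ {a}) := by
    intro a ha
    by_contra! hn
    have hsub : P.carrier ⊆ (span (P.carrier ∪ {a})).carrier :=
      Set.subset_union_left.trans (subset_span _)
    exact ha (hM.le_of_ge ⟨_, rfl, hn⟩ hsub (subset_span _ (Or.inr rfl)))
  refine ⟨P, ⟨fun h => hP 0 (by simpa using h), fun a b hab => ?_⟩, hIM,
    fun h => hP 1 (by simpa using h)⟩
  by_contra! hcon
  obtain ⟨m, hm⟩ := big a hcon.1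
  obtain ⟨n, hn⟩ := big b hcon.2
  refine hP (m + n) ?_
  rw [pow_add]
  refine mul_mem_of_span ?_ hm hn
  rintro x (hx | rfl) y (hy | rfl)
  · exact P.mul_mem _ _ hy
  · rw [mul_comm]; exact P.mul_mem _ _ hx
  · exact P.mul_mem _ _ hy
  · exact hab

end MIdeal

/-- `spec(A)`. -/
def Spec (A : Type u) [MultiringStruct A] : Type u := {p : MIdeal A // p.IsPrime}

/-- The basic open set `D(a) = {p ∈ spec(A) : a ∉ p}`. -/
def D {A : Type u} [MultiringStruct A] (a : A) : Set (Spec A) := {p | a ∉ p.1}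

/-- The Zariski topology on `spec(A)`, generated by the sets `D(a)`. -/
instance (A : Type u) [MultiringStruct A] : TopologicalSpace (Spec A) :=
  TopologicalSpace.generateFrom (Set.range (D (A := A)))

/-! ### Quotient by an ideal -/

section Quotient

variable {A : Type u} [MultiringStruct A] [IsMultiring A]

theorem sub_meets_iff (I : MIdeal A) (a b : A) :
    (∃ i ∈ a +ₕ (-b), i ∈ I) ↔ ∃ i ∈ I, a ∈ b +ₕ i := by
  constructor
  · rintro ⟨i, hi, hI⟩
    refine ⟨i, hI, mem_add_comm ?_⟩
    have := (IsMultiring.reversible _ _ _ hi).2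
    rwa [neg_neg'] at this
  · rintro ⟨i, hI, hi⟩
    exact ⟨i, mem_add_comm (IsMultiring.reversible _ _ _ hi).1, hI⟩

/-- The congruence `a ∼ b ↔ (a - b) ∩ I ≠ ∅`. -/
def MIdeal.con (I : MIdeal A) : Con A where
  r a b := ∃ i ∈ a +ₕ (-b), i ∈ I
  iseqv := by
    refine ⟨fun a => ⟨0, zero_mem_add_neg a, I.zero_mem⟩, ?_, ?_⟩
    · rintro a b ⟨i, hi, hI⟩
      refine ⟨-i, mem_add_comm ?_, MIdeal.neg_mem hI⟩
      have := neg_mem_add hi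
      rwa [neg_neg'] at this
    · intro a b c h1 h2
      rw [sub_meets_iff] at *
      obtain ⟨i, hI, hi⟩ := h1
      obtain ⟨j, hJ, hj⟩ := h2
      obtain ⟨k, hk, ha⟩ := IsMultiring.add_assoc _ _ _ _ _ hj hi
      exact ⟨k, I.add_mem _ hJ _ hI hk, ha⟩
  mul' := by
    intro a b c d h1 h2
    rw [sub_meets_iff] at *
    obtain ⟨i, hI, hi⟩ := h1
    obtain ⟨j, hJ, hj⟩ := h2
    have h1 := IsMultiring.half_distrib _ _ _ c hi
    have h2 : b * c ∈ b * d +ₕ b * j :=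
      mul_mem_add b hj (mul_comm _ _) (mul_comm _ _) (mul_comm _ _)
    obtain ⟨k, hk, ha⟩ := IsMultiring.add_assoc _ _ _ _ _ h2 h1
    refine ⟨k, I.add_mem _ (I.mul_mem _ _ hJ) _ ?_ hk, ha⟩
    rw [mul_comm]; exact I.mul_mem _ _ hI

/-- The quotient `A / I`. -/
abbrev IdealQuot (I : MIdeal A) : Type u := I.con.Quotient

/-- The projection `A → A / I`. -/
def proj (I : MIdeal A) (a : A) : IdealQuot I := (a : I.con.Quotient)

theorem proj_eq_iff (I : MIdeal A) {a b : A} : proj I a = proj I b ↔ ∃ i ∈ I, a ∈ b +ₕ i :=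
  (Con.eq I.con).trans (sub_meets_iff I a b)

theorem proj_mul (I : MIdeal A) (a b : A) : proj I (a * b) = proj I a * proj I b := rfl

theorem proj_surj (I : MIdeal A) (x : IdealQuot I) : ∃ a, proj I a = x :=
  Quotient.exists_rep (s := I.con.toSetoid) x

instance (I : MIdeal A) : MultiringStruct (IdealQuot I) where
  zero := proj I 0
  neg := Quotient.map' (s₁ := I.con.toSetoid) (s₂ := I.con.toSetoid) (fun a => -a) (by
    rintro a b ⟨i, hi, hI⟩
    exact ⟨-i, neg_mem_add hi, MIdeal.neg_mem hI⟩)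
  hadd x y := {z | ∃ a b c : A, proj I a = z ∧ proj I b = x ∧ proj I c = y ∧ a ∈ b +ₕ c}

theorem proj_zero (I : MIdeal A) : proj I 0 = 0 := rfl

theorem proj_neg (I : MIdeal A) (a : A) : proj I (-a) = -proj I a := rfl

theorem proj_mem_add_iff (I : MIdeal A) {a b c : A} :
    proj I a ∈ proj I b +ₕ proj I c ↔ ∃ a', proj I a' = proj I a ∧ a' ∈ b +ₕ c := by
  constructor
  · rintro ⟨a', b', c', ha, hb, hc, h⟩
    obtain ⟨i, hi, hb⟩ := (proj_eq_iff I).1 hb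
    obtain ⟨j, hj, hc⟩ := (proj_eq_iff I).1 hc
    obtain ⟨k, hk, l, hl, h⟩ := add_add_add_comm' h hb hc
    exact ⟨k, ((proj_eq_iff I).2 ⟨l, I.add_mem _ hi _ hj hl, h⟩).symm.trans ha, hk⟩
  · rintro ⟨a', ha, h⟩
    exact ⟨a', b, c, ha, rfl, rfl, h⟩

theorem proj_mem_add (I : MIdeal A) {a b c : A} (h : a ∈ b +ₕ c) :
    proj I a ∈ proj I b +ₕ proj I c := ⟨a, b, c, rfl, rfl, rfl, h⟩

theorem proj_eq_zero_iff (I : MIdeal A) {a : A} : proj I a = 0 ↔ a ∈ I := by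
  rw [← proj_zero, proj_eq_iff]
  constructor
  · rintro ⟨i, hi, h⟩
    rwa [(IsMultiring.mem_add_zero _ _).1 (mem_add_comm h)]
  · exact fun h => ⟨a, h, mem_add_comm (self_mem_add_zero a)⟩

instance (I : MIdeal A) : IsMultiring (IdealQuot I) where
  add_nonempty x y := by
    obtain ⟨a, rfl⟩ := proj_surj I x
    obtain ⟨b, rfl⟩ := proj_surj I y
    obtain ⟨c, hc⟩ := IsMultiring.add_nonempty a b
    exact ⟨_, proj_mem_add I hc⟩
  reversible := by
    rintro _ _ _ ⟨a, b, c, rfl, rfl, rfl, h⟩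
    have := IsMultiring.reversible _ _ _ h
    exact ⟨proj_mem_add I this.1, proj_mem_add I this.2⟩
  mem_add_zero x y := by
    obtain ⟨a, rfl⟩ := proj_surj I x
    obtain ⟨b, rfl⟩ := proj_surj I y
    rw [← proj_zero, proj_mem_add_iff]
    constructor
    · rintro ⟨a', ha, h⟩
      rw [← ha, (IsMultiring.mem_add_zero _ _).1 h]
    · exact fun h => ⟨b, h.symm, self_mem_add_zero b⟩
  add_assoc x y z g t hg ht := by
    obtain ⟨a, rfl⟩ := proj_surj I x
    obtain ⟨b, rfl⟩ := proj_surj I y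
    obtain ⟨c, rfl⟩ := proj_surj I z
    obtain ⟨g, rfl⟩ := proj_surj I g
    obtain ⟨t, rfl⟩ := proj_surj I t
    obtain ⟨g', hg', hg⟩ := (proj_mem_add_iff I).1 hg
    rw [← hg'] at ht
    obtain ⟨t', ht', ht⟩ := (proj_mem_add_iff I).1 ht
    obtain ⟨h, hh, ht⟩ := IsMultiring.add_assoc _ _ _ _ _ hg ht
    exact ⟨proj I h, proj_mem_add I hh, ht' ▸ proj_mem_add I ht⟩
  add_comm x y := by
    ext z
    constructor <;>
    · rintro ⟨a, b, c, rfl, rfl, rfl, h⟩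
      exact proj_mem_add I (mem_add_comm h)
  mul_zero x := by
    obtain ⟨a, rfl⟩ := proj_surj I x
    rw [← proj_zero, ← proj_mul, IsMultiring.mul_zero]
  half_distrib := by
    rintro _ _ _ x ⟨a, b, c, rfl, rfl, rfl, h⟩
    obtain ⟨d, rfl⟩ := proj_surj I x
    exact proj_mem_add I (IsMultiring.half_distrib _ _ _ d h)

end Quotient

/-! ### Localization -/

section Localization

variable {A : Type u} [MultiringStruct A] [IsMultiring A] (S : Submonoid A)

theorem mk_eq_iff {a b : A} {s t : S} : Localization.mk a s = Localization.mk b t ↔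
    ∃ v : S, a * t * v = b * s * v := by
  rw [Localization.mk_eq_mk_iff, Localization.r_iff_exists]
  refine exists_congr fun v => ?_
  rw [show (v : A) * ((t : A) * a) = a * t * v by ac_rfl,
    show (v : A) * ((s : A) * b) = b * s * v by ac_rfl]

/-- The multiring structure of `S⁻¹A`, on Mathlib's localization of commutative monoids:
`a/s ∈ b/t + c/u` iff `atuv ∈ bsuv + cstv` for some `v ∈ S` (see `mk_mem_add_iff`), the zero is
`0/1` and `-(a/s) = (-a)/s`. -/
instance : MultiringStruct (Localization S) where
  toZero := inferInstance
  neg x := x.liftOn (fun a s => Localization.mk (-a) s) (by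
    intro a c b d h
    obtain ⟨v, hv⟩ := (mk_eq_iff S).1 (Localization.mk_eq_mk_iff.2 h)
    exact (mk_eq_iff S).2 ⟨v, by rw [neg_mul', neg_mul', neg_mul', neg_mul', hv]⟩)
  hadd x y := {z | ∃ (a b c : A) (s t u v : S), z = Localization.mk a s ∧
    x = Localization.mk b t ∧ y = Localization.mk c u ∧
    a * t * u * v ∈ b * s * u * v +ₕ c * s * t * v}

theorem mk_zero_one : (Localization.mk 0 1 : Localization S) = 0 :=
  OreLocalization.zero_def.symm

theorem mk_neg (a : A) (s : S) : Localization.mk (-a) s = -Localization.mk a s := rfl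

theorem mk_mem_add_iff {a b c : A} {s t u : S} :
    Localization.mk a s ∈ Localization.mk b t +ₕ Localization.mk c u ↔
      ∃ v : S, a * t * u * v ∈ b * s * u * v +ₕ c * s * t * v := by
  constructor
  · rintro ⟨a', b', c', s', t', u', v, ha, hb, hc, h⟩
    obtain ⟨k, hk⟩ := (mk_eq_iff S).1 ha
    obtain ⟨l, hl⟩ := (mk_eq_iff S).1 hb
    obtain ⟨m, hm⟩ := (mk_eq_iff S).1 hc
    refine ⟨v * k * l * m * s' * t' * u', mul_mem_add (s * t * u * k * l * m : A) h ?_ ?_ ?_⟩ <;>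
      push_cast
    · rw [show a' * t' * u' * v * (s * t * u * k * l * m : A) =
        (a' * s * k) * (t' * u' * v * t * u * l * m) by ac_rfl, ← hk]; ac_rfl
    · rw [show b' * s' * u' * v * (s * t * u * k * l * m : A) =
        (b' * t * l) * (s' * u' * v * s * u * k * m) by ac_rfl, ← hl]; ac_rfl
    · rw [show c' * s' * t' * v * (s * t * u * k * l * m : A) =
        (c' * u * m) * (s' * t' * v * s * t * k * l) by ac_rfl, ← hm]; ac_rfl
  · rintro ⟨v, h⟩
    exact ⟨a, b, c, s, t, u, v, rfl, rfl, rfl, h⟩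

instance : IsMultiring (Localization S) where
  add_nonempty x y := by
    induction x using Localization.induction_on with | _ x =>
    induction y using Localization.induction_on with | _ y =>
    obtain ⟨a, ha⟩ := IsMultiring.add_nonempty (x.1 * y.2) (y.1 * x.2)
    refine ⟨Localization.mk a (x.2 * y.2), (mk_mem_add_iff S).2 ⟨1,
      mul_mem_add (x.2 * y.2 : A) ha ?_ ?_ ?_⟩⟩ <;> push_cast <;> rw [mul_one] <;> ac_rfl
  reversible x y z h := by
    obtain ⟨a, b, c, s, t, u, v, rfl, rfl, rfl, h⟩ := h
    have := IsMultiring.reversible _ _ _ h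
    rw [← mk_neg, ← mk_neg, mk_mem_add_iff, mk_mem_add_iff]
    refine ⟨⟨v, mul_mem_add 1 this.1 ?_ ?_ ?_⟩, ⟨v, mul_mem_add 1 this.2 ?_ ?_ ?_⟩⟩ <;>
      simp only [neg_mul', mul_one] <;> ac_rfl
  mem_add_zero x y := by
    induction x using Localization.induction_on with | _ x =>
    induction y using Localization.induction_on with | _ y =>
    rw [← mk_zero_one, mk_mem_add_iff, mk_eq_iff]
    simp only [zero_mul', IsMultiring.mem_add_zero, Submonoid.coe_one, mul_one]
  add_assoc x y z g w hg hw := by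
    induction x using Localization.induction_on with | _ x =>
    induction y using Localization.induction_on with | _ y =>
    induction z using Localization.induction_on with | _ z =>
    induction g using Localization.induction_on with | _ g =>
    induction w using Localization.induction_on with | _ w =>
    obtain ⟨a, s⟩ := x
    obtain ⟨b, t⟩ := y
    obtain ⟨c, u⟩ := z
    obtain ⟨g, m⟩ := g
    obtain ⟨x, r⟩ := w
    obtain ⟨v, hg⟩ := (mk_mem_add_iff S).1 hg
    obtain ⟨w, hw⟩ := (mk_mem_add_iff S).1 hw
    dsimp only at hg hw
    have hg := IsMultiring.half_distrib _ _ _ (r * u * w : A) hg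
    have hw : x * m * u * w * s * t * v ∈
        (g * s * t * v * (r * u * w : A)) +ₕ (c * r * m * w * (s * t * v)) := by
      refine mul_mem_add (s * t * v : A) hw ?_ ?_ rfl <;> ac_rfl
    obtain ⟨h, hh, hx⟩ := IsMultiring.add_assoc _ _ _ _ _ hg hw
    refine ⟨Localization.mk h (m * s * v * r * w * t * u), (mk_mem_add_iff S).2 ⟨1, ?_⟩,
      (mk_mem_add_iff S).2 ⟨1, ?_⟩⟩ <;> push_cast <;> simp only [mul_one]
    · refine mul_mem_add (t * u : A) hh ?_ ?_ ?_ <;> ac_rfl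
    · refine mul_mem_add (s * r : A) hx ?_ ?_ ?_ <;> ac_rfl
  add_comm x y := by
    ext z
    constructor <;>
    · rintro ⟨a, b, c, s, t, u, v, rfl, rfl, rfl, h⟩
      rw [mk_mem_add_iff]
      refine ⟨v, mem_add_comm ?_⟩
      exact mul_mem_add 1 h (by rw [mul_one]; ac_rfl) (mul_one _) (mul_one _)
  mul_zero x := by
    induction x using Localization.induction_on with | _ x =>
    rw [← mk_zero_one, Localization.mk_mul, mk_eq_iff]
    exact ⟨1, by simp only [IsMultiring.mul_zero, zero_mul']⟩
  half_distrib x y z d h := by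
    obtain ⟨a, b, c, s, t, u, v, rfl, rfl, rfl, h⟩ := h
    induction d using Localization.induction_on with | _ d =>
    rw [Localization.mk_mul, Localization.mk_mul, Localization.mk_mul, mk_mem_add_iff]
    refine ⟨v, mul_mem_add (d.1 * d.2 * d.2 : A) h ?_ ?_ ?_⟩ <;> push_cast <;> ac_rfl

/-- The canonical map `S⁻¹A → T⁻¹A`, `a/s ↦ a/s`, for `S ⊆ T`. -/
def locMap {S T : Submonoid A} (h : S ≤ T) (x : Localization S) : Localization T :=
  x.liftOn (fun a s => Localization.mk a ⟨s, h s.2⟩) (by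
    intro a c b d hr
    obtain ⟨v, hv⟩ := (mk_eq_iff S).1 (Localization.mk_eq_mk_iff.2 hr)
    exact (mk_eq_iff T).2 ⟨⟨v, h v.2⟩, hv⟩)

end Localization

/-! ### The residue hyperfields and the von Neumann hull -/

section Hull

variable {A : Type u} [MultiringStruct A] [IsMultiring A]

/-- The nonzero elements of the multidomain `A / p`. -/
def nonzero (p : Spec A) : Submonoid (IdealQuot p.1) where
  carrier := {x | x ≠ 0}
  one_mem' := fun h => p.2.one_notMem ((proj_eq_zero_iff p.1).1 h)
  mul_mem' := by
    intro x y hx hy h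
    obtain ⟨a, rfl⟩ := proj_surj p.1 x
    obtain ⟨b, rfl⟩ := proj_surj p.1 y
    rw [← proj_mul, proj_eq_zero_iff] at h
    rcases p.2.mem_or_mem _ _ h with h | h
    · exact hx ((proj_eq_zero_iff _).2 h)
    · exact hy ((proj_eq_zero_iff _).2 h)

/-- `K_A(p)`, the fraction hyperfield of `A / p`. -/
abbrev ResidueField (p : Spec A) : Type u := Localization (nonzero p)

/-- The element `x / y` of `K_A(p)`, for `y ∉ p`. -/
def frac (p : Spec A) (x y : A) (hy : y ∉ p.1) : ResidueField p :=
  Localization.mk (proj p.1 x) ⟨proj p.1 y, fun h => hy ((proj_eq_zero_iff p.1).1 h)⟩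

/-- `f` is a constructible section: locally for the constructible topology of `spec(A)`, it is
given by a fraction `x / y` of elements of `A`. -/
def IsConstructibleSection (f : ∀ p : Spec A, ResidueField p) : Prop :=
  ∀ p : Spec A, ∃ U : Set (Spec A), @IsClopen _ (constructibleTopology (Spec A)) U ∧ p ∈ U ∧
    ∃ (x y : A) (hU : U ⊆ D y), ∀ (q : Spec A) (hq : q ∈ U), f q = frac q x y (hU hq)

variable (A)

/-- The constructible sections, with their pointwise product. -/
def sections : Submonoid (∀ p : Spec A, ResidueField p) where
  carrier := {f | IsConstructibleSection f}
  one_mem' p := ⟨Set.univ, @isClopen_univ _ (constructibleTopology _), trivial, 1, 1,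
    fun q _ => q.2.one_notMem, fun _ _ => Localization.mk_one.symm⟩
  mul_mem' := by
    intro f g hf hg p
    obtain ⟨U, hU, hpU, x, y, hUy, hfx⟩ := hf p
    obtain ⟨V, hV, hpV, z, w, hVw, hgz⟩ := hg p
    refine ⟨U ∩ V, @IsClopen.inter _ (constructibleTopology _) _ _ hU hV, ⟨hpU, hpV⟩, x * z, y * w,
      fun q hq h => (q.2.mem_or_mem _ _ h).elim (hUy hq.1) (hVw hq.2), fun q hq => ?_⟩
    rw [Pi.mul_apply, hfx q hq.1, hgz q hq.2]
    exact Localization.mk_mul _ _ _ _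

/-- The von Neumann hull `V(A)`. -/
abbrev VonNeumannHull : Type u := sections A

/-- All operations of `V(A)` are pointwise; `f ∈ g + h` iff `f(p) ∈ g(p) + h(p)` for all `p`. -/
instance : MultiringStruct (VonNeumannHull A) where
  zero := ⟨fun _ => 0, fun p => ⟨Set.univ, @isClopen_univ _ (constructibleTopology _), trivial,
    0, 1, fun q _ => q.2.one_notMem, fun q _ => (mk_zero_one (nonzero q)).symm⟩⟩
  neg f := ⟨fun p => -f.1 p, fun p => by
    obtain ⟨U, hU, hpU, x, y, hUy, hfx⟩ := f.2 p
    refine ⟨U, hU, hpU, -x, y, hUy, fun q hq => ?_⟩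
    show -f.1 q = _
    rw [hfx q hq]; rfl⟩
  hadd g h := {f | ∀ p : Spec A, f.1 p ∈ g.1 p +ₕ h.1 p}

end Hull

/-! ### Orders and the real reduced hull -/

/-- The sign hyperfield `3 = {-1, 0, 1}`: `0 + x = {x}`, `x + x = {x}`, `1 + (-1) = {1, 0, -1}`. -/
instance : MultiringStruct SignType where
  hadd a b := {c | (a = 0 ∧ c = b) ∨ (b = 0 ∧ c = a) ∨ (a = b ∧ c = a) ∨ (a ≠ 0 ∧ a = -b)}

/-- Morphisms of multirings. -/
structure MultiringHom (A : Type u) (B : Type*) [MultiringStruct A] [MultiringStruct B]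
    extends A →* B where
  map_add' : ∀ a b c : A, a ∈ b +ₕ c → toFun a ∈ toFun b +ₕ toFun c
  map_zero' : toFun 0 = 0
  map_neg' : ∀ a : A, toFun (-a) = -toFun a

/-- The real spectrum `sper(A)`: the set of all orders, i.e. morphisms `A → 3`. -/
abbrev Sper (A : Type u) [MultiringStruct A] : Type u := MultiringHom A SignType

/-- The map `A → 3^{sper(A)}`, `a ↦ (σ ↦ σ(a))`. -/
def hat (A : Type u) [MultiringStruct A] : A →* (Sper A → SignType) where
  toFun a σ := σ.toMonoidHom a
  map_one' := funext fun σ => map_one σ.toMonoidHom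
  map_mul' a b := funext fun σ => map_mul σ.toMonoidHom a b

/-- `Q(A)`, the image of `A` in `3^{sper(A)}`, with the product induced by that of `A`. -/
abbrev RealReducedHull (A : Type u) [MultiringStruct A] : Type u := MonoidHom.mrange (hat A)

/-- The operations of `Q(A)` are those induced by `A`; `x ∈ y + z` iff `a ∈ b + c` for some
representatives `a, b, c` of `x, y, z`. -/
instance (A : Type u) [MultiringStruct A] : MultiringStruct (RealReducedHull A) where
  zero := ⟨hat A 0, 0, rfl⟩
  neg x := ⟨fun σ => -x.1 σ, by
    obtain ⟨a, ha⟩ := x.2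
    exact ⟨-a, funext fun σ => (σ.map_neg' a).trans (by rw [← ha]; rfl)⟩⟩
  hadd y z := {x | ∃ a b c : A, hat A a = x.1 ∧ hat A b = y.1 ∧ hat A c = z.1 ∧ a ∈ b +ₕ c}

/-! ### The structural presheaf and geometric multirings -/

section Presheaf

variable {A : Type u} [MultiringStruct A] [IsMultiring A]

/-- `S_a = {x : aⁿ ∈ (x) for some n ≥ 0}`. -/
def satPowers (a : A) : Submonoid A where
  carrier := {x | ∃ n : ℕ, a ^ n ∈ MIdeal.span {x}}
  one_mem' := ⟨0, MIdeal.subset_span _ (by simp)⟩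
  mul_mem' := by
    rintro x y ⟨m, hm⟩ ⟨n, hn⟩
    refine ⟨m + n, ?_⟩
    rw [pow_add]
    refine MIdeal.mul_mem_of_span ?_ hm hn
    rintro _ rfl _ rfl
    exact MIdeal.subset_span _ rfl

theorem satPowers_le_of_D_subset {a b : A} (h : D a ⊆ D b) : satPowers b ≤ satPowers a := by
  rintro x ⟨n, hn⟩
  by_contra hx
  have hx : ∀ m : ℕ, a ^ m ∉ MIdeal.span {x} := fun m hm => hx ⟨m, hm⟩
  obtain ⟨P, hP, hxP, ha⟩ := MIdeal.exists_prime hx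
  exact h (show (⟨P, hP⟩ : Spec A) ∈ D a from ha) (MIdeal.pow_mem_imp hP n (hxP hn))

theorem D_mul (a b : A) : D (a * b) = D a ∩ D b := by
  ext p
  constructor
  · exact fun h => ⟨fun ha => h (by rw [mul_comm]; exact p.1.mul_mem _ _ ha),
      fun hb => h (p.1.mul_mem _ _ hb)⟩
  · exact fun h hab => (p.2.mem_or_mem _ _ hab).elim h.1 h.2

/-- The structural presheaf `F(D(a)) = S_a⁻¹A`. -/
abbrev presheaf (a : A) : Type u := Localization (satPowers a)

/-- The restriction map `F(D(b)) → F(D(a))`, for `D(a) ⊆ D(b)`. -/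
def res {a b : A} (h : D a ⊆ D b) : presheaf b → presheaf a := locMap (satPowers_le_of_D_subset h)

theorem D_subset_of_cover {e : A} {ι : Type u} {d : ι → A} (h : D e = ⋃ i, D (d i)) (i : ι) :
    D (d i) ⊆ D e := h ▸ Set.subset_iUnion (fun i => D (d i)) i

theorem D_mul_subset_left (a b : A) : D (a * b) ⊆ D a := D_mul a b ▸ Set.inter_subset_left

theorem D_mul_subset_right (a b : A) : D (a * b) ⊆ D b := D_mul a b ▸ Set.inter_subset_right

variable (A)

/-- The structural presheaf of `A` is a monopresheaf. -/
def IsMono : Prop :=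
  ∀ (e : A) (ι : Type u) (d : ι → A) (h : D e = ⋃ i, D (d i)) (a b c : presheaf e),
    (∀ i, res (D_subset_of_cover h i) a ∈
      res (D_subset_of_cover h i) b +ₕ res (D_subset_of_cover h i) c) → a ∈ b +ₕ c

/-- `A` is geometric: its structural presheaf is a sheaf. -/
structure IsGeometric : Prop where
  mono : IsMono A
  glue : ∀ (e : A) (ι : Type u) (d : ι → A) (h : D e = ⋃ i, D (d i)) (x : ∀ i, presheaf (d i)),
    (∀ i j, res (D_mul_subset_left (d i) (d j)) (x i) =
      res (D_mul_subset_right (d i) (d j)) (x j)) →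
    ∃ y : presheaf e, ∀ i, res (D_subset_of_cover h i) y = x i

end Presheaf

/-- Geometric von Neumann hyperrings. -/
structure IsGeometricVonNeumannHyperring (A : Type u) [MultiringStruct A] : Prop
    extends IsVonNeumannHyperring A where
  geometric : IsGeometric A

end Multiring

/-! Von Neumann hull. The operations of V(A) are pointwise, so any law that asserts no existence
holds as soon as it holds in every K_A(p). The laws of a real reduced multiring are put in such a
form (`IsReduced`): a³ = a, uniqueness in a + b²a, uniqueness in a² + b². These pass to quotients
and localizations, hence to K_A(p). There squares are 0 or 1 and 1 + 1 = {1}, so a sum of squares is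
0 or 1 and never -1; evaluation at one prime then shows that V(A) is semireal.

Non-empty sums and associativity do ask for a section. A value chosen at p is a fraction, and a
membership between fractions at p is witnessed by some c ∉ p, some i ∈ p and relations in A. It
therefore persists on a constructible clopen neighbourhood of p. The constructible topology is
compact, by ultrafilter limits of primes, so finitely many local choices are patched along clopen
sets (`exists_section`).

Real reduced hull. Addition in Q(A) allows arbitrary representatives. In a von Neumann hyperring two
representatives g, g' of one element satisfy gu = g'v with u, v positive at every order
(`exists_mul_eq_mul_of_toHull_eq`). Such factors become 1 in Q(A), so the axioms descend from A.

Since a³ = a in Q(A), localizing over D(e) amounts to multiplying by the idempotent e². The elements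
over whose supports a membership holds, or a family glues, form an ideal: idempotents have
complements, so elements can be patched, and this can be checked on signs. An ideal containing the
members of a cover of D(e) contains e (`mem_of_cover`), which is the sheaf property. -/

namespace Multiring

/-! ### Compactness of the spectrum -/

section SpecCompact

variable {A : Type u} [MultiringStruct A] [IsMultiring A]

open Topology Filter

/-- The ideal of the elements that lie in `F`-almost all primes. -/
def ultraIdeal (F : Ultrafilter (Spec A)) : MIdeal A where
  carrier := {a | ∀ᶠ p in (F : Filter (Spec A)), a ∈ p.1}
  zero_mem := Eventually.of_forall fun p => p.1.zero_mem
  add_mem a ha b hb x hx := by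
    filter_upwards [ha, hb] with p h1 h2 using p.1.add_mem a h1 b h2 hx
  mul_mem a b hb := by
    filter_upwards [hb] with p h using p.1.mul_mem a b h

theorem ultraIdeal_isPrime (F : Ultrafilter (Spec A)) : (ultraIdeal F).IsPrime where
  one_notMem h := by
    have h : ∀ᶠ p in (F : Filter (Spec A)), (1 : A) ∈ p.1 := h
    obtain ⟨p, hp⟩ := h.exists
    exact p.2.one_notMem hp
  mem_or_mem a b h := by
    have h : ∀ᶠ p in (F : Filter (Spec A)), a * b ∈ p.1 := h
    exact Ultrafilter.eventually_or.1 (h.mono fun p hp => p.2.mem_or_mem a b hp)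

/-- The limit of an ultrafilter on the spectrum. -/
def ultraPrime (F : Ultrafilter (Spec A)) : Spec A := ⟨ultraIdeal F, ultraIdeal_isPrime F⟩

theorem ultraPrime_mem_D_iff (F : Ultrafilter (Spec A)) (a : A) : ultraPrime F ∈ D a ↔ D a ∈ F :=
  Ultrafilter.eventually_not.symm

theorem le_nhds_ultraPrime (F : Ultrafilter (Spec A)) :
    (F : Filter (Spec A)) ≤ 𝓝 (ultraPrime F) := by
  rw [TopologicalSpace.nhds_generateFrom]
  refine le_iInf₂ fun s hs => ?_
  obtain ⟨hs, a, rfl⟩ := hs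
  exact le_principal_iff.2 ((ultraPrime_mem_D_iff F a).1 hs)

theorem isOpen_D (a : A) : IsOpen (D a) :=
  TopologicalSpace.isOpen_generateFrom_of_mem ⟨a, rfl⟩

theorem isCompact_D (a : A) : IsCompact (D a) := by
  rw [isCompact_iff_ultrafilter_le_nhds]
  intro F hF
  exact ⟨ultraPrime F, (ultraPrime_mem_D_iff F a).2 (le_principal_iff.1 hF), le_nhds_ultraPrime F⟩

theorem isTopologicalBasis_D :
    TopologicalSpace.IsTopologicalBasis (Set.range (D (A := A))) where
  exists_subset_inter := by
    rintro _ ⟨a, rfl⟩ _ ⟨b, rfl⟩ p hp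
    exact ⟨D (a * b), ⟨_, rfl⟩, by rwa [D_mul], (D_mul a b).subset⟩
  sUnion_eq := Set.eq_univ_of_forall fun p => ⟨D 1, ⟨1, rfl⟩, p.2.one_notMem⟩
  eq_generateFrom := rfl

/-- Compact open sets and closed sets with compact complement are both open in the constructible
topology; `D a` is of the first kind and its complement of the second. -/
theorem isClopen_D (a : A) : @IsClopen _ (constructibleTopology (Spec A)) (D a) := by
  refine ⟨@IsClosed.mk _ (constructibleTopology _) _ ?_,
    (isCompact_D a).isOpen_constructibleTopology_of_isOpen (isOpen_D a)⟩
  refine IsCompact.isOpen_constructibleTopology_of_isClosed ?_ (isOpen_D a).isClosed_compl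
  rw [compl_compl]
  exact isCompact_D a

/-- The Zariski limit `ultraPrime F` is also a limit of `F` for the finer topology, as is checked on
the two kinds of generating open sets. -/
theorem isCompact_univ_constructible :
    @IsCompact _ (constructibleTopology (Spec A)) Set.univ := by
  refine (@isCompact_iff_ultrafilter_le_nhds _ (constructibleTopology (Spec A)) _).2 fun F _ =>
    ⟨ultraPrime F, trivial, ?_⟩
  rw [constructibleTopology, TopologicalSpace.nhds_generateFrom]
  refine le_iInf₂ fun s hs => le_principal_iff.2 ?_
  obtain ⟨hp, ⟨ho, -⟩ | ⟨ho, hc⟩⟩ := hs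
  · exact le_nhds_ultraPrime F (ho.mem_nhds hp)
  -- Otherwise `F` has a Zariski limit `q` in the compact set `sᶜ`. Some `D a ⊆ sᶜ` around `q`
  -- belongs to `F`, so it contains `ultraPrime F`, which lies in `s`.
  · by_contra hF
    have hF : sᶜ ∈ F := Ultrafilter.compl_mem_iff_notMem.2 hF
    obtain ⟨q, hq, hle⟩ := isCompact_iff_ultrafilter_le_nhds.1 hc F (le_principal_iff.2 hF)
    obtain ⟨_, ⟨a, rfl⟩, hqa, has⟩ :=
      isTopologicalBasis_D.exists_subset_of_mem_open hq ho.isOpen_compl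
    exact has ((ultraPrime_mem_D_iff F a).2 (hle ((isOpen_D a).mem_nhds hqa))) hp

end SpecCompact

/-! ### Fractions in the residue hyperfields -/

section Frac

variable {A : Type u} [MultiringStruct A] [IsMultiring A]

theorem exists_frac {p : Spec A} (k : ResidueField p) :
    ∃ (x y : A) (hy : y ∉ p.1), k = frac p x y hy := by
  induction k using Localization.induction_on with | _ k =>
  obtain ⟨x, y, hy⟩ := k
  obtain ⟨x, rfl⟩ := proj_surj _ x
  obtain ⟨y, rfl⟩ := proj_surj _ y
  exact ⟨x, y, fun h => hy ((proj_eq_zero_iff p.1).2 h), rfl⟩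

/-- Everything is expressed by elements and relations of `A`. The prime enters only through `c ∉ p`
and `i ∈ p`, which are constructible conditions. -/
theorem frac_mem_add_iff {p : Spec A} {x y z w t v : A} (hy : y ∉ p.1) (hw : w ∉ p.1)
    (hv : v ∉ p.1) : frac p x y hy ∈ frac p z w hw +ₕ frac p t v hv ↔
      ∃ c ∉ p.1, ∃ i ∈ p.1, ∃ a, a ∈ (x * w * v * c) +ₕ i ∧
        a ∈ (z * y * v * c) +ₕ (t * y * w * c) := by
  rw [frac, frac, frac, mk_mem_add_iff]
  constructor
  · rintro ⟨⟨c, hc⟩, h⟩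
    obtain ⟨c, rfl⟩ := proj_surj _ c
    simp only [← proj_mul] at h
    obtain ⟨a, ha, h⟩ := (proj_mem_add_iff _).1 h
    obtain ⟨i, hi, ha⟩ := (proj_eq_iff _).1 ha
    exact ⟨c, fun h => hc ((proj_eq_zero_iff p.1).2 h), i, hi, a, ha, h⟩
  · rintro ⟨c, hc, i, hi, a, ha, h⟩
    refine ⟨⟨proj p.1 c, fun h => hc ((proj_eq_zero_iff p.1).1 h)⟩, ?_⟩
    simp only [← proj_mul]
    exact (proj_mem_add_iff _).2 ⟨a, (proj_eq_iff _).2 ⟨i, hi, ha⟩, h⟩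

/-- A membership between fractions spreads out to a constructible neighbourhood. -/
theorem exists_isClopen_frac_mem_add {p : Spec A} {x y z w t v : A} {hy : y ∉ p.1} {hw : w ∉ p.1}
    {hv : v ∉ p.1} (h : frac p x y hy ∈ frac p z w hw +ₕ frac p t v hv) :
    ∃ U : Set (Spec A), @IsClopen _ (constructibleTopology (Spec A)) U ∧ p ∈ U ∧
      ∀ q ∈ U, ∀ (hy : y ∉ q.1) (hw : w ∉ q.1) (hv : v ∉ q.1),
        frac q x y hy ∈ frac q z w hw +ₕ frac q t v hv := by
  obtain ⟨c, hc, i, hi, a, ha, h⟩ := (frac_mem_add_iff _ _ _).1 h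
  refine ⟨D c ∩ (D i)ᶜ, @IsClopen.inter _ (constructibleTopology _) _ _ (isClopen_D c)
    (@IsClopen.compl _ (constructibleTopology _) _ (isClopen_D i)), ⟨hc, fun h => h hi⟩,
    fun q hq hy hw hv => (frac_mem_add_iff _ _ _).2 ⟨c, hq.1, i, not_not.1 hq.2, a, ha, h⟩⟩

/-- Local choices of fractions can be patched to a constructible section. -/
theorem exists_section {P : ∀ p : Spec A, ResidueField p → Prop}
    (h : ∀ p : Spec A, ∃ U : Set (Spec A), @IsClopen _ (constructibleTopology (Spec A)) U ∧ p ∈ U ∧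
      ∃ (x y : A) (hU : U ⊆ D y), ∀ (q : Spec A) (hq : q ∈ U), P q (frac q x y (hU hq))) :
    ∃ f : VonNeumannHull A, ∀ p, P p (f.1 p) := by
  have key : ∃ W : Set (Spec A), @IsClopen _ (constructibleTopology (Spec A)) W ∧ Set.univ ⊆ W ∧
      ∃ f : ∀ p : Spec A, ResidueField p, ∀ p ∈ W, P p (f p) ∧
        ∃ U : Set (Spec A), @IsClopen _ (constructibleTopology (Spec A)) U ∧ p ∈ U ∧
          ∃ (x y : A) (hU : U ⊆ D y), ∀ (q : Spec A) (hq : q ∈ U), f q = frac q x y (hU hq) := by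
    let T := constructibleTopology (Spec A)
    refine @IsCompact.induction_on _ T _ isCompact_univ_constructible (fun S =>
      ∃ W : Set (Spec A), @IsClopen _ T W ∧ S ⊆ W ∧
        ∃ f : ∀ p : Spec A, ResidueField p, ∀ p ∈ W, P p (f p) ∧
          ∃ U : Set (Spec A), @IsClopen _ T U ∧ p ∈ U ∧
            ∃ (x y : A) (hU : U ⊆ D y), ∀ (q : Spec A) (hq : q ∈ U), f q = frac q x y (hU hq))
      ?_ ?_ ?_ ?_
    · exact ⟨∅, @isClopen_empty _ T, subset_rfl, fun _ => 0, fun p hp => hp.elim⟩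
    · rintro s t hst ⟨W, hW, htW, hf⟩
      exact ⟨W, hW, hst.trans htW, hf⟩
    · rintro s t ⟨W, hW, hsW, f, hf⟩ ⟨W', hW', htW', g, hg⟩
      classical
      refine ⟨W ∪ W', @IsClopen.union _ T _ _ hW hW', Set.union_subset_union hsW htW',
        fun q => if q ∈ W then f q else g q, fun p hp => ?_⟩
      by_cases hpW : p ∈ W
      · obtain ⟨hP, U, hU, hpU, x, y, hUy, hfx⟩ := hf p hpW
        simp only [hpW, if_true]
        -- The patched function follows `f` on `W` and `g` elsewhere. Intersecting with `W`, or
        -- below with `Wᶜ`, gives a clopen neighbourhood on which a single choice applies.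
        refine ⟨hP, U ∩ W, @IsClopen.inter _ T _ _ hU hW, ⟨hpU, hpW⟩, x, y,
          Set.inter_subset_left.trans hUy, fun q hq => ?_⟩
        rw [if_pos hq.2, hfx q hq.1]
      · obtain ⟨hP, U, hU, hpU, x, y, hUy, hfx⟩ := hg p (hp.resolve_left hpW)
        simp only [hpW, if_false]
        refine ⟨hP, U ∩ Wᶜ, @IsClopen.inter _ T _ _ hU (@IsClopen.compl _ T _ hW), ⟨hpU, hpW⟩,
          x, y, Set.inter_subset_left.trans hUy, fun q hq => ?_⟩
        rw [if_neg hq.2, hfx q hq.1]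
    · intro p _
      obtain ⟨U, hU, hpU, x, y, hUy, hP⟩ := h p
      classical
      refine ⟨U, @mem_nhdsWithin_of_mem_nhds _ T _ _ _ (@IsOpen.mem_nhds _ T _ _ hU.2 hpU), U, hU,
        subset_rfl, fun q => if hq : q ∈ U then frac q x y (hUy hq) else 0, fun q hq => ?_⟩
      simp only [hq, dif_pos]
      exact ⟨hP q hq, U, hU, hq, x, y, hUy, fun r hr => by rw [dif_pos hr]⟩
  obtain ⟨W, -, hW, f, hf⟩ := key
  exact ⟨⟨f, fun p => (hf p (hW trivial)).2⟩, fun p => (hf p (hW trivial)).1⟩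

end Frac

/-! ### The von Neumann hull is a multiring -/

section HullMultiring

variable {A : Type u} [MultiringStruct A] [IsMultiring A]

theorem VonNeumannHull.mem_add_iff {f g h : VonNeumannHull A} :
    f ∈ g +ₕ h ↔ ∀ p, f.1 p ∈ g.1 p +ₕ h.1 p := Iff.rfl

theorem frac_mul_mem_add {p : Spec A} {x y z w t : A} (hy : y ∉ p.1) (hw : w ∉ p.1)
    (hyw : y * w ∉ p.1) (ht : t ∈ (x * w) +ₕ (z * y)) :
    frac p t (y * w) hyw ∈ frac p x y hy +ₕ frac p z w hw := by
  refine (frac_mem_add_iff _ _ _).2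
    ⟨1, p.2.one_notMem, 0, p.1.zero_mem, _, self_mem_add_zero _, ?_⟩
  refine mul_mem_add (y * w) ht ?_ ?_ ?_ <;> rw [mul_one] <;> ac_rfl

/-- Only non-emptiness and associativity require the construction of a section; the other axioms are
read off at each prime. -/
instance : IsMultiring (VonNeumannHull A) where
  add_nonempty f g := by
    refine exists_section (P := fun p k => k ∈ f.1 p +ₕ g.1 p) fun p => ?_
    obtain ⟨U, hU, hpU, x, y, hUy, hf⟩ := f.2 p
    obtain ⟨V, hV, hpV, z, w, hVw, hg⟩ := g.2 p
    -- Taken in `A` over a common denominator, the numerator `t` works at every prime of `U ∩ V` at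
    -- once.
    obtain ⟨t, ht⟩ := IsMultiring.add_nonempty (x * w) (z * y)
    refine ⟨U ∩ V, @IsClopen.inter _ (constructibleTopology _) _ _ hU hV, ⟨hpU, hpV⟩, t, y * w,
      fun q hq => (D_mul y w).symm ▸ ⟨hUy hq.1, hVw hq.2⟩, fun q hq => ?_⟩
    rw [hf q hq.1, hg q hq.2]
    exact frac_mul_mem_add _ _ _ ht
  reversible f g h hf :=
    ⟨fun p => (IsMultiring.reversible _ _ _ (hf p)).1,
      fun p => (IsMultiring.reversible _ _ _ (hf p)).2⟩
  mem_add_zero f g := by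
    rw [VonNeumannHull.mem_add_iff, Subtype.ext_iff, funext_iff]
    exact forall_congr' fun p => IsMultiring.mem_add_zero _ _
  add_assoc a b c g x hg hx := by
    suffices h : ∃ h : VonNeumannHull A,
        ∀ p, h.1 p ∈ b.1 p +ₕ c.1 p ∧ x.1 p ∈ a.1 p +ₕ h.1 p by
      obtain ⟨h, hh⟩ := h
      exact ⟨h, fun p => (hh p).1, fun p => (hh p).2⟩
    refine exists_section (P := fun p k => k ∈ b.1 p +ₕ c.1 p ∧ x.1 p ∈ a.1 p +ₕ k) fun p => ?_
    -- Associativity in `K_A(p)` gives a value at `p` only; both of its memberships then spread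
    -- along a fraction representing it.
    obtain ⟨k, hk, hxk⟩ := IsMultiring.add_assoc _ _ _ _ _ (hg p) (hx p)
    obtain ⟨r, s, hs, rfl⟩ := exists_frac k
    obtain ⟨U₁, hU₁, hpU₁, a₁, a₂, ha₂, ha⟩ := a.2 p
    obtain ⟨U₂, hU₂, hpU₂, b₁, b₂, hb₂, hb⟩ := b.2 p
    obtain ⟨U₃, hU₃, hpU₃, c₁, c₂, hc₂, hc⟩ := c.2 p
    obtain ⟨U₄, hU₄, hpU₄, x₁, x₂, hx₂, hx⟩ := x.2 p
    rw [hb p hpU₂, hc p hpU₃] at hk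
    rw [ha p hpU₁, hx p hpU₄] at hxk
    obtain ⟨V, hV, hpV, hk⟩ := exists_isClopen_frac_mem_add hk
    obtain ⟨W, hW, hpW, hxk⟩ := exists_isClopen_frac_mem_add hxk
    have inter := @IsClopen.inter _ (constructibleTopology (Spec A))
    refine ⟨U₁ ∩ U₂ ∩ U₃ ∩ U₄ ∩ V ∩ W ∩ D s,
      inter (inter (inter (inter (inter (inter hU₁ hU₂) hU₃) hU₄) hV) hW) (isClopen_D s),
      ⟨⟨⟨⟨⟨⟨hpU₁, hpU₂⟩, hpU₃⟩, hpU₄⟩, hpV⟩, hpW⟩, hs⟩, r, s, fun q hq => hq.2, ?_⟩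
    rintro q ⟨⟨⟨⟨⟨⟨hqU₁, hqU₂⟩, hqU₃⟩, hqU₄⟩, hqV⟩, hqW⟩, hqs⟩
    rw [hb q hqU₂, hc q hqU₃, ha q hqU₁, hx q hqU₄]
    exact ⟨hk q hqV _ _ _, hxk q hqW _ _ _⟩
  add_comm f g := by
    ext h
    exact forall_congr' fun p => by rw [IsMultiring.add_comm]
  mul_zero f := Subtype.ext (funext fun p => IsMultiring.mul_zero (f.1 p))
  half_distrib f g h k hf p := IsMultiring.half_distrib _ _ _ (k.1 p) (hf p)

end HullMultiring

/-! ### The equational laws of real reduced multirings -/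

theorem sq_mul_sq_of_cube {M : Type*} [Monoid M] (hc : ∀ a : M, a ^ 3 = a) (a : M) :
    a ^ 2 * a ^ 2 = a ^ 2 := by
  rw [← pow_add, show 2 + 2 = 3 + 1 from rfl, pow_succ, hc, pow_two]

/-- The laws of a real reduced multiring, apart from `-1 ∉ ∑ A²`, with single-valuedness in place
of equalities of sets. -/
structure IsReduced (A : Type u) [MultiringStruct A] : Prop where
  cube : ∀ a : A, a ^ 3 = a
  eq_of_mem_add_sq_mul : ∀ a b x : A, x ∈ a +ₕ b ^ 2 * a → x = a
  eq_of_mem_sq_add_sq : ∀ a b x y : A, x ∈ (a ^ 2) +ₕ (b ^ 2) → y ∈ (a ^ 2) +ₕ (b ^ 2) → x = y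

namespace IsReduced

variable {A : Type u} [MultiringStruct A] [IsMultiring A]

theorem quotient (hA : IsReduced A) (I : MIdeal A) : IsReduced (IdealQuot I) where
  cube x := by
    obtain ⟨a, rfl⟩ := proj_surj I x
    exact congrArg (proj I) (hA.cube a)
  eq_of_mem_add_sq_mul x y z h := by
    obtain ⟨a, rfl⟩ := proj_surj I x
    obtain ⟨b, rfl⟩ := proj_surj I y
    obtain ⟨c, rfl⟩ := proj_surj I z
    obtain ⟨c', hc, h⟩ := (proj_mem_add_iff I (c := b ^ 2 * a)).1 h
    rw [← hc, hA.eq_of_mem_add_sq_mul _ _ _ h]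
  eq_of_mem_sq_add_sq x y z w hz hw := by
    obtain ⟨a, rfl⟩ := proj_surj I x
    obtain ⟨b, rfl⟩ := proj_surj I y
    obtain ⟨c, rfl⟩ := proj_surj I z
    obtain ⟨d, rfl⟩ := proj_surj I w
    obtain ⟨c', hc, hz⟩ := (proj_mem_add_iff I (b := a ^ 2) (c := b ^ 2)).1 hz
    obtain ⟨d', hd, hw⟩ := (proj_mem_add_iff I (b := a ^ 2) (c := b ^ 2)).1 hw
    rw [← hc, ← hd, hA.eq_of_mem_sq_add_sq _ _ _ _ hz hw]

theorem localization (hA : IsReduced A) (S : Submonoid A) : IsReduced (Localization S) where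
  cube x := by
    induction x using Localization.induction_on with | _ x =>
    obtain ⟨a, s⟩ := x
    rw [Localization.mk_pow, hA.cube, show s ^ 3 = s from Subtype.ext (hA.cube s)]
  eq_of_mem_add_sq_mul x y z h := by
    induction x using Localization.induction_on with | _ x =>
    induction y using Localization.induction_on with | _ y =>
    induction z using Localization.induction_on with | _ z =>
    obtain ⟨a, s⟩ := x
    obtain ⟨b, t⟩ := y
    obtain ⟨c, m⟩ := z
    rw [Localization.mk_pow, Localization.mk_mul, mk_mem_add_iff] at h
    obtain ⟨v, h⟩ := h
    push_cast at h
    have ht := sq_mul_sq_of_cube hA.cube (t : A)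
    -- Multiplication by `t ^ 2`, an idempotent, turns the two summands into `α` and `b ^ 2 * α`
    -- with `α = a * m * s * v * t ^ 2`, the shape of the law in `A`.
    have h' := mul_mem_add (b' := a * m * s * v * (t ^ 2 : A))
      (c' := b ^ 2 * (a * m * s * v * (t ^ 2 : A))) (t ^ 2 : A) h rfl
      (by rw [show a * m * (t ^ 2 * s : A) * v * (t ^ 2 : A) =
            a * m * s * v * (t ^ 2 * t ^ 2 : A) by ac_rfl, ht]) (by ac_rfl)
    refine (mk_eq_iff S).2 ⟨s * v * t ^ 2, ?_⟩
    have := hA.eq_of_mem_add_sq_mul _ _ _ h'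
    rw [show c * s * (t ^ 2 * s : A) * v * (t ^ 2 : A) =
      c * s * s * v * (t ^ 2 * t ^ 2 : A) by ac_rfl, ht] at this
    push_cast
    rw [show c * s * (s * v * t ^ 2 : A) = c * s * s * v * t ^ 2 by ac_rfl, this]
    ac_rfl
  eq_of_mem_sq_add_sq x y z w hz hw := by
    induction x using Localization.induction_on with | _ x =>
    induction y using Localization.induction_on with | _ y =>
    induction z using Localization.induction_on with | _ z =>
    induction w using Localization.induction_on with | _ w =>
    obtain ⟨a, s⟩ := x
    obtain ⟨b, t⟩ := y
    obtain ⟨c, m⟩ := z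
    obtain ⟨d, n⟩ := w
    rw [Localization.mk_pow, Localization.mk_pow, mk_mem_add_iff] at hz hw
    obtain ⟨v, hz⟩ := hz
    obtain ⟨w, hw⟩ := hw
    push_cast at hz hw
    -- The multipliers here and in `hw` are chosen so that both memberships acquire the same two
    -- summands, each a perfect square.
    have hz := mul_mem_add (b' := (a * m * n * t * v * w : A) ^ 2)
      (c' := (b * m * n * s * v * w : A) ^ 2) (m * v * n * n * w * w : A) hz rfl
      (by simp only [pow_two]; ac_rfl) (by simp only [pow_two]; ac_rfl)
    have hw := mul_mem_add (b' := (a * m * n * t * v * w : A) ^ 2)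
      (c' := (b * m * n * s * v * w : A) ^ 2) (n * w * m * m * v * v : A) hw rfl
      (by simp only [pow_two]; ac_rfl) (by simp only [pow_two]; ac_rfl)
    have h := hA.eq_of_mem_sq_add_sq _ _ _ _ hz hw
    refine (mk_eq_iff S).2 ⟨s ^ 2 * t ^ 2 * v ^ 2 * w ^ 2 * m * n, ?_⟩
    push_cast
    simp only [pow_two] at h ⊢
    calc _ = _ := by ac_rfl
      _ = _ := h
      _ = _ := by ac_rfl

theorem residueField (hA : IsReduced A) (p : Spec A) : IsReduced (ResidueField p) :=
  (hA.quotient p.1).localization (nonzero p)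

end IsReduced

/-! ### The von Neumann hull of a real reduced multiring -/

section HullRealReduced

variable {A : Type u} [MultiringStruct A] [IsMultiring A]

theorem IsRealReducedMultiring.isReduced (hA : IsRealReducedMultiring A) : IsReduced A where
  cube := hA.cube
  eq_of_mem_add_sq_mul a b x h := by rwa [hA.add_sq_mul] at h
  eq_of_mem_sq_add_sq a b _ _ hx hy := (hA.sq_add_sq a b).unique hx hy

theorem residueField_one_ne_zero (p : Spec A) : (1 : ResidueField p) ≠ 0 := by
  rw [← Localization.mk_one, ← mk_zero_one, Ne, mk_eq_iff]
  rintro ⟨v, hv⟩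
  refine v.2 ?_
  simpa only [Submonoid.coe_one, one_mul, zero_mul'] using hv

/-- For `x, y ∉ p`, the equality x² = y² holds in A/p after multiplication by xy, since x³y = xy =
xy³. -/
theorem residueField_sq_eq (hA : IsReduced A) {p : Spec A} (k : ResidueField p) :
    k ^ 2 = 0 ∨ k ^ 2 = 1 := by
  obtain ⟨x, y, hy, rfl⟩ := exists_frac k
  rw [frac, Localization.mk_pow]
  by_cases hx : x ∈ p.1
  · left
    rw [(proj_eq_zero_iff p.1).2 hx, pow_two, zero_mul', ← mk_zero_one, mk_eq_iff]
    exact ⟨1, by rw [zero_mul', zero_mul', zero_mul', zero_mul']⟩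
  · right
    have h3 : ∀ a : A, proj p.1 a * proj p.1 a * proj p.1 a = proj p.1 a := fun a => by
      rw [← pow_two, ← pow_succ]
      exact (hA.quotient p.1).cube _
    rw [← Localization.mk_one, mk_eq_iff]
    refine ⟨⟨proj p.1 x, fun h => hx ((proj_eq_zero_iff p.1).1 h)⟩ *
      ⟨proj p.1 y, fun h => hy ((proj_eq_zero_iff p.1).1 h)⟩, ?_⟩
    push_cast
    simp only [pow_two, mul_one, one_mul]
    calc _ = (proj p.1 x * proj p.1 x * proj p.1 x) * proj p.1 y := by ac_rfl
      _ = proj p.1 x * (proj p.1 y * proj p.1 y * proj p.1 y) := by rw [h3, h3]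
      _ = _ := by ac_rfl

/-- The set {0, 1} is stable under adding a square, because the law for a + b²a at a = b = 1 gives 1
+ 1 = {1}. -/
theorem residueField_listSum_sq (hA : IsReduced A) {p : Spec A} (l : List (ResidueField p)) :
    ∀ x ∈ listSum (l.map fun a => a ^ 2), x = 0 ∨ x = 1 := by
  induction l with
  | nil => exact fun x hx => Or.inl hx
  | cons a l ih =>
    rintro x ⟨y, hy, hx⟩
    rcases ih y hy with rfl | rfl
    · rw [(IsMultiring.mem_add_zero _ _).1 hx]
      exact residueField_sq_eq hA a
    · right
      dsimp only at hx
      rcases residueField_sq_eq hA a with ha | ha <;> rw [ha] at hx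
      · exact (IsMultiring.mem_add_zero _ _).1 (mem_add_comm hx)
      · refine (hA.residueField p).eq_of_mem_add_sq_mul 1 1 x ?_
        rwa [one_pow, one_mul]

/-- If -1 = 0 then 1 = 0; if -1 = 1 then 0 ∈ 1 + 1 = {1}. -/
theorem residueField_isSemireal (hA : IsReduced A) (p : Spec A) :
    IsSemireal (ResidueField p) := by
  rintro ⟨l, hl⟩
  have h10 := residueField_one_ne_zero p
  rcases residueField_listSum_sq hA l _ hl with h | h
  · exact h10 (by rw [← neg_neg' (1 : ResidueField p), h, neg_zero'])
  · refine h10 ((hA.residueField p).eq_of_mem_add_sq_mul 1 1 0 ?_).symm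
    rw [one_pow, one_mul]
    have h0 := zero_mem_add_neg (1 : ResidueField p)
    rwa [h] at h0

theorem VonNeumannHull.listSum_apply (p : Spec A) (l : List (VonNeumannHull A)) :
    ∀ f ∈ listSum l, f.1 p ∈ listSum (l.map fun g => g.1 p) := by
  induction l with
  | nil =>
    rintro f (rfl : f = 0)
    exact (rfl : (0 : ResidueField p) = 0)
  | cons g l ih =>
    rintro f ⟨h, hh, hf⟩
    exact ⟨h.1 p, ih h hh, hf p⟩

theorem nonempty_spec (h : (1 : A) ≠ 0) : Nonempty (Spec A) := by
  let I : MIdeal A := ⟨{0}, rfl, by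
    rintro _ rfl _ rfl x hx
    exact (IsMultiring.mem_add_zero _ _).1 hx, by
    rintro a _ rfl
    exact IsMultiring.mul_zero a⟩
  obtain ⟨P, hP, -⟩ := MIdeal.exists_prime (I := I) (c := 1) fun n hn => h (by
    rw [one_pow] at hn; exact hn)
  exact ⟨⟨P, hP⟩⟩

theorem IsRealReducedMultiring.one_ne_zero (hA : IsRealReducedMultiring A) : (1 : A) ≠ 0 := by
  refine fun h => hA.semireal ⟨[], ?_⟩
  rw [h, neg_zero']
  exact (rfl : (0 : A) = 0)

theorem vonNeumannHull_isRealReduced (hA : IsRealReducedMultiring A) :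
    IsRealReducedMultiring (VonNeumannHull A) := by
  have hK := fun p : Spec A => hA.isReduced.residueField p
  refine { (inferInstance : IsMultiring (VonNeumannHull A)) with
    semireal := ?_, cube := ?_, add_sq_mul := ?_, sq_add_sq := ?_ }
  · rintro ⟨l, hl⟩
    obtain ⟨p⟩ := nonempty_spec hA.one_ne_zero
    refine residueField_isSemireal hA.isReduced p ⟨l.map fun g => g.1 p, ?_⟩
    have := VonNeumannHull.listSum_apply p _ _ hl
    rw [List.map_map] at this ⊢
    exact this
  · exact fun f => Subtype.ext (funext fun p => (hK p).cube (f.1 p))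
  · intro f g
    refine (IsMultiring.add_nonempty _ _).subset_singleton_iff.1 fun h hh => ?_
    exact Subtype.ext (funext fun p => (hK p).eq_of_mem_add_sq_mul _ (g.1 p) _ (hh p))
  · intro f g
    obtain ⟨h, hh⟩ := IsMultiring.add_nonempty (f ^ 2) (g ^ 2)
    exact ⟨h, hh, fun k hk => Subtype.ext (funext fun p =>
      (hK p).eq_of_mem_sq_add_sq (f.1 p) (g.1 p) _ _ (hk p) (hh p))⟩

end HullRealReduced


/-! ### Idempotents of hyperrings -/

section Idempotent

variable {A : Type u} [MultiringStruct A] [IsMultiring A]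

theorem mem_zero_add_iff {a b : A} : a ∈ 0 +ₕ b ↔ a = b := by
  rw [IsMultiring.add_comm, IsMultiring.mem_add_zero]

/-- Idempotents of a hyperring have complements. -/
theorem exists_compl (hA : IsHyperring A) {e : A} (he : e * e = e) :
    ∃ k, e * k = 0 ∧ (1 : A) ∈ e +ₕ k := by
  -- An element `f` of 1 - e need not be annihilated by `e`. It is corrected to some `k ∈ f - f * e`
  -- with `k * e = 0`, which distributivity extracts from 0 ∈ fe - fe·e.
  obtain ⟨f, hf⟩ := IsMultiring.add_nonempty 1 (-e)
  have h1 := (IsMultiring.reversible _ _ _ hf).2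
  rw [neg_neg'] at h1
  have h0 : 0 ∈ (f * e) +ₕ (-(f * e) * e) := by
    rw [neg_mul', mul_assoc, he]
    exact zero_mem_add_neg _
  obtain ⟨k, hk, hke⟩ := hA.distrib _ _ _ _ h0
  have hfk := (IsMultiring.reversible _ _ _ hk).2
  rw [neg_neg'] at hfk
  -- Here `h ∈ f * e + e` is a multiple of `e` by distributivity. Multiplying `1 ∈ k + h` by `e`
  -- kills `k` and gives `h = e`.
  obtain ⟨h, hh, hkh⟩ := IsMultiring.add_assoc _ _ _ _ _ hfk h1
  obtain ⟨m, -, rfl⟩ := hA.distrib f 1 e h (by rwa [one_mul])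
  have := IsMultiring.half_distrib _ _ _ e hkh
  rw [← hke, one_mul, mul_assoc, he, mem_zero_add_iff] at this
  exact ⟨k, by rw [mul_comm, hke], mem_add_comm (this ▸ hkh)⟩

end Idempotent

/-! ### The sign hyperfield -/

section Sign

theorem sign_mem_add_iff {a b c : SignType} : a ∈ b +ₕ c ↔
    (b = 0 ∧ a = c) ∨ (c = 0 ∧ a = b) ∨ (b = c ∧ a = b) ∨ (b ≠ 0 ∧ b = -c) := Iff.rfl

theorem sign_mem_add_zero_iff {a b : SignType} : a ∈ b +ₕ 0 ↔ a = b := by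
  rw [sign_mem_add_iff]; revert a b; decide

theorem sign_mem_zero_add_iff {a b : SignType} : a ∈ 0 +ₕ b ↔ a = b := by
  rw [sign_mem_add_iff]; revert a b; decide

theorem sign_mul_self_of_ne_zero {a : SignType} : a ≠ 0 → a * a = 1 := by
  revert a; decide

end Sign

/-! ### The real reduced hull as a multiring -/

section HullQ

variable {A : Type u} [MultiringStruct A]

/-- The projection `A → Q(A)`. -/
def toHull : A →* RealReducedHull A := (hat A).mrangeRestrict

theorem toHull_surjective : Function.Surjective (toHull (A := A)) :=
  (hat A).mrangeRestrict_surjective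

theorem toHull_apply (a : A) (σ : Sper A) : (toHull a).1 σ = σ.toMonoidHom a := rfl

theorem toHull_neg (a : A) : toHull (-a) = -toHull a :=
  Subtype.ext (funext fun σ => σ.map_neg' a)

theorem RealReducedHull.zero_apply (σ : Sper A) : (0 : RealReducedHull A).1 σ = 0 := σ.map_zero'

theorem RealReducedHull.one_apply (σ : Sper A) : (1 : RealReducedHull A).1 σ = 1 := rfl

theorem RealReducedHull.mul_apply (x y : RealReducedHull A) (σ : Sper A) :
    (x * y).1 σ = x.1 σ * y.1 σ := rfl

theorem RealReducedHull.ext {x y : RealReducedHull A} (h : ∀ σ, x.1 σ = y.1 σ) : x = y :=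
  Subtype.ext (funext h)

theorem toHull_mem_add {a b c : A} (h : a ∈ b +ₕ c) : toHull a ∈ toHull b +ₕ toHull c :=
  ⟨a, b, c, rfl, rfl, rfl, h⟩

theorem RealReducedHull.apply_mem_add {x y z : RealReducedHull A} (h : x ∈ y +ₕ z) (σ : Sper A) :
    x.1 σ ∈ y.1 σ +ₕ z.1 σ := by
  obtain ⟨a, b, c, ha, hb, hc, h⟩ := h
  rw [← ha, ← hb, ← hc]
  exact σ.map_add' _ _ _ h

theorem sper_mul_eq_zero_or [IsMultiring A] (σ : Sper A) {a b : A} (h : a * b = 0) :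
    σ.toMonoidHom a = 0 ∨ σ.toMonoidHom b = 0 := by
  rw [← mul_eq_zero, ← map_mul, h]
  exact σ.map_zero'

variable [IsMultiring A]

/-- Two elements of a von Neumann hyperring have the same signs only if they agree up to factors
that are positive everywhere. -/
theorem exists_mul_eq_mul_of_toHull_eq (hA : IsVonNeumannHyperring A) {g g' : A}
    (h : toHull g = toHull g') :
    ∃ u v : A, toHull u = 1 ∧ toHull v = 1 ∧ g * u = g' * v := by
  -- With `g = g ^ 2 * b`, the product `g * b` is idempotent; its complement annihilates `g` and has
  -- sign 1 wherever `g` vanishes.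
  have compl : ∀ g : A, ∃ k, g * k = 0 ∧ ∀ σ : Sper A, σ.toMonoidHom g = 0 →
      σ.toMonoidHom k = 1 := by
    intro g
    obtain ⟨b, hb⟩ := hA.regular g
    obtain ⟨k, hk, h1⟩ := exists_compl hA.toIsHyperring (e := g * b) (by
      rw [show g * b * (g * b) = g ^ 2 * b * b by rw [pow_two]; ac_rfl, ← hb])
    refine ⟨k, ?_, fun σ hσ => ?_⟩
    · rw [hb, show g ^ 2 * b * k = g * (g * b * k) by rw [pow_two]; ac_rfl, hk,
        IsMultiring.mul_zero]
    · have : σ.toMonoidHom 1 ∈ σ.toMonoidHom (g * b) +ₕ σ.toMonoidHom k := σ.map_add' _ _ _ h1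
      rw [map_mul, hσ, zero_mul, sign_mem_zero_add_iff, map_one] at this
      exact this.symm
  obtain ⟨k, hk, hkσ⟩ := compl g
  obtain ⟨k', hk', hkσ'⟩ := compl g'
  -- At every order exactly one of the two summands is nonzero, and it has sign 1, so `u` and `v`
  -- are positive everywhere. Multiplying `u` by `g` and `v` by `g'` kills `k * k'` and leaves gg'²
  -- both times.
  obtain ⟨u, hu⟩ := IsMultiring.add_nonempty (g' * g') (k * k')
  obtain ⟨v, hv⟩ := IsMultiring.add_nonempty (g * g') (k * k')
  have hσ : ∀ σ : Sper A, σ.toMonoidHom g = σ.toMonoidHom g' := fun σ =>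
    congrFun (congrArg Subtype.val h) σ
  have pos : ∀ w : A, w ∈ (g' * g') +ₕ (k * k') ∨ w ∈ (g * g') +ₕ (k * k') → toHull w = 1 := by
    intro w hw
    refine RealReducedHull.ext fun σ => ?_
    rw [toHull_apply, RealReducedHull.one_apply]
    have hw' : σ.toMonoidHom w ∈ σ.toMonoidHom (g' * g') +ₕ σ.toMonoidHom (k * k') := by
      rcases hw with hw | hw
      · exact σ.map_add' _ _ _ hw
      · have := σ.map_add' _ _ _ hw
        change σ.toMonoidHom w ∈ σ.toMonoidHom (g * g') +ₕ σ.toMonoidHom (k * k') at this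
        rwa [map_mul _ g, hσ, ← map_mul] at this
    rw [map_mul, map_mul] at hw'
    by_cases h0 : σ.toMonoidHom g' = 0
    · rw [hkσ σ (by rw [hσ, h0]), hkσ' σ h0, h0, mul_one, zero_mul,
        sign_mem_zero_add_iff] at hw'
      exact hw'
    · rw [(sper_mul_eq_zero_or σ hk').resolve_left h0, sign_mul_self_of_ne_zero h0, mul_zero,
        sign_mem_add_zero_iff] at hw'
      exact hw'
  refine ⟨u, v, pos u (Or.inl hu), pos v (Or.inr hv), ?_⟩
  have hu := mul_mem_add (a' := g * u) (b' := g * g' * g') (c' := 0) g hu (by ac_rfl) (by ac_rfl)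
    (by rw [show k * k' * g = g * k * k' by ac_rfl, hk, zero_mul'])
  have hv := mul_mem_add (a' := g' * v) (b' := g * g' * g') (c' := 0) g' hv (by ac_rfl) (by ac_rfl)
    (by rw [show k * k' * g' = g' * k' * k by ac_rfl, hk', zero_mul'])
  rw [IsMultiring.mem_add_zero] at hu hv
  rw [hu, hv]

/-- Representatives of the summands can be prescribed, up to factors that become 1 in the hull. This
allows sums in `Q(A)` to be composed in `A`. -/
theorem exists_mem_add_of_toHull_mem_add (hA : IsVonNeumannHyperring A) {x : RealReducedHull A}
    {b c : A} (h : x ∈ toHull b +ₕ toHull c) :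
    ∃ a u v : A, toHull u = 1 ∧ toHull v = 1 ∧ toHull a = x ∧ a ∈ (b * u) +ₕ (c * v) := by
  obtain ⟨a, b', c', ha, hb, hc, h⟩ := h
  obtain ⟨p, p', hp, hp', hbp⟩ := exists_mul_eq_mul_of_toHull_eq hA (Subtype.ext hb)
  obtain ⟨r, r', hr, hr', hcr⟩ := exists_mul_eq_mul_of_toHull_eq hA (Subtype.ext hc)
  refine ⟨a * (p * r), p' * r, r' * p, ?_, ?_, ?_, mul_mem_add (p * r) h rfl ?_ ?_⟩
  · rw [map_mul, hp', hr, mul_one]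
  · rw [map_mul, hr', hp, mul_one]
  · rw [map_mul, map_mul, hp, hr, mul_one, mul_one]
    exact Subtype.ext ha
  · rw [← mul_assoc, hbp, mul_assoc]
  · rw [mul_comm p r, ← mul_assoc, hcr, mul_assoc]

theorem realReducedHull_isVonNeumannHyperring (hA : IsVonNeumannHyperring A) :
    IsVonNeumannHyperring (RealReducedHull A) where
  add_nonempty x y := by
    obtain ⟨a, rfl⟩ := toHull_surjective x
    obtain ⟨b, rfl⟩ := toHull_surjective y
    obtain ⟨c, hc⟩ := IsMultiring.add_nonempty a b
    exact ⟨_, toHull_mem_add hc⟩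
  reversible x y z h := by
    obtain ⟨a, b, c, ha, hb, hc, h⟩ := h
    obtain rfl : toHull a = x := Subtype.ext ha
    obtain rfl : toHull b = y := Subtype.ext hb
    obtain rfl : toHull c = z := Subtype.ext hc
    rw [← toHull_neg, ← toHull_neg]
    exact ⟨toHull_mem_add (IsMultiring.reversible _ _ _ h).1,
      toHull_mem_add (IsMultiring.reversible _ _ _ h).2⟩
  mem_add_zero x y := by
    constructor
    · intro h
      refine RealReducedHull.ext fun σ => ?_
      have := RealReducedHull.apply_mem_add h σ
      rwa [RealReducedHull.zero_apply, sign_mem_add_zero_iff] at this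
    · rintro rfl
      obtain ⟨a, rfl⟩ := toHull_surjective x
      exact toHull_mem_add (self_mem_add_zero a)
  add_assoc x y z g w hg hw := by
    obtain ⟨a, rfl⟩ := toHull_surjective x
    obtain ⟨b, rfl⟩ := toHull_surjective y
    obtain ⟨c, rfl⟩ := toHull_surjective z
    obtain ⟨g, u, v, hu, hv, rfl, hg'⟩ := exists_mem_add_of_toHull_mem_add hA hg
    obtain ⟨w, p, r, hp, hr, rfl, hw'⟩ := exists_mem_add_of_toHull_mem_add hA hw
    -- The second sum starts from `g * p`, so the first is multiplied by `p` before associativity in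
    -- `A` applies.
    obtain ⟨h, hh, hw⟩ := IsMultiring.add_assoc _ _ _ _ _ (IsMultiring.half_distrib _ _ _ p hg') hw'
    have hh := toHull_mem_add hh
    have hw := toHull_mem_add hw
    simp only [map_mul, hu, hv, hp, hr, mul_one] at hh hw
    exact ⟨_, hh, hw⟩
  add_comm x y := by
    ext z
    constructor <;>
    · rintro ⟨a, b, c, ha, hb, hc, h⟩
      exact ⟨a, c, b, ha, hc, hb, mem_add_comm h⟩
  mul_zero x := RealReducedHull.ext fun σ => by
    rw [RealReducedHull.mul_apply, RealReducedHull.zero_apply, mul_zero]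
  half_distrib x y z d h := by
    obtain ⟨a, b, c, ha, hb, hc, h⟩ := h
    obtain rfl : toHull a = x := Subtype.ext ha
    obtain rfl : toHull b = y := Subtype.ext hb
    obtain rfl : toHull c = z := Subtype.ext hc
    obtain ⟨d, rfl⟩ := toHull_surjective d
    simp only [← map_mul]
    exact toHull_mem_add (IsMultiring.half_distrib _ _ _ d h)
  distrib y z d x h := by
    obtain ⟨b, rfl⟩ := toHull_surjective y
    obtain ⟨c, rfl⟩ := toHull_surjective z
    obtain ⟨d, rfl⟩ := toHull_surjective d
    rw [← map_mul, ← map_mul] at h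
    obtain ⟨x, u, v, hu, hv, rfl, h'⟩ := exists_mem_add_of_toHull_mem_add hA h
    rw [mul_right_comm, mul_right_comm c] at h'
    obtain ⟨a, ha, rfl⟩ := hA.distrib _ _ _ _ h'
    refine ⟨toHull a, ?_, map_mul _ _ _⟩
    have ha := toHull_mem_add ha
    rwa [map_mul, map_mul, hu, hv, mul_one, mul_one] at ha
  regular x := by
    obtain ⟨a, rfl⟩ := toHull_surjective x
    obtain ⟨b, hb⟩ := hA.regular a
    exact ⟨toHull b, by rw [← map_pow, ← map_mul, ← hb]⟩

theorem RealReducedHull.cube (x : RealReducedHull A) : x ^ 3 = x := by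
  refine RealReducedHull.ext fun σ => ?_
  change x.1 σ ^ 3 = x.1 σ
  generalize x.1 σ = s
  revert s; decide

end HullQ

/-! ### The structural presheaf of a hyperring with `a³ = a` -/

section CubePresheaf

variable {B : Type u} [MultiringStruct B] [IsMultiring B]

/-- The multiples of `s`, an ideal of a hyperring. -/
def MIdeal.multiples (hB : IsHyperring B) (s : B) : MIdeal B where
  carrier := {x | ∃ y, x = y * s}
  zero_mem := ⟨0, (zero_mul' s).symm⟩
  add_mem := by
    rintro _ ⟨a, rfl⟩ _ ⟨b, rfl⟩ x hx
    obtain ⟨y, -, hy⟩ := hB.distrib _ _ _ _ hx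
    exact ⟨y, hy⟩
  mul_mem := by
    rintro a _ ⟨b, rfl⟩
    exact ⟨a * b, (mul_assoc _ _ _).symm⟩

/-- Every denominator allowed over `D e` divides the idempotent `e ^ 2`, itself such a denominator.
Hence relations in `presheaf e` can be tested after multiplication by `e ^ 2` alone. -/
theorem exists_mul_eq_sq (hB : IsHyperring B) (hc : ∀ a : B, a ^ 3 = a) {e s : B}
    (hs : s ∈ satPowers e) : ∃ y, s * y = e ^ 2 := by
  obtain ⟨n, hn⟩ := hs
  obtain ⟨y, hy⟩ := MIdeal.span_le (I := MIdeal.multiples hB s)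
    (Set.singleton_subset_iff.2 ⟨1, (one_mul s).symm⟩) hn
  -- The exponent n + 2 makes the total 2(n + 1), even and positive, so that the power collapses to
  -- `e ^ 2`.
  refine ⟨y * e ^ (n + 2), ?_⟩
  have he := sq_mul_sq_of_cube hc e
  have hpow : ∀ m : ℕ, (e ^ 2) ^ (m + 1) = e ^ 2 := fun m => by
    induction m with
    | zero => rw [pow_one]
    | succ m ih => rw [pow_succ, ih, he]
  rw [← mul_assoc, mul_comm s, ← hy, ← pow_add, show n + (n + 2) = 2 * (n + 1) by omega,
    pow_mul, hpow]

theorem sq_mem_satPowers (e : B) : e ^ 2 ∈ satPowers e := ⟨2, MIdeal.subset_span _ rfl⟩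

theorem presheaf_exists_mk_one (hB : IsHyperring B) (hc : ∀ a : B, a ^ 3 = a) {e : B}
    (x : presheaf e) : ∃ a : B, x = Localization.mk a 1 := by
  induction x using Localization.induction_on with | _ x =>
  obtain ⟨b, s, hs⟩ := x
  obtain ⟨y, hy⟩ := exists_mul_eq_sq hB hc hs
  refine ⟨b * y, (mk_eq_iff _).2 ⟨⟨e ^ 2, sq_mem_satPowers e⟩, ?_⟩⟩
  dsimp only
  rw [Submonoid.coe_one, mul_one, mul_assoc b y s, mul_comm y s, hy, mul_assoc,
    sq_mul_sq_of_cube hc]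

theorem presheaf_mk_one_eq_iff (hB : IsHyperring B) (hc : ∀ a : B, a ^ 3 = a) {e a b : B} :
    (Localization.mk a 1 : presheaf e) = Localization.mk b 1 ↔ a * e ^ 2 = b * e ^ 2 := by
  rw [mk_eq_iff]
  simp only [Submonoid.coe_one, mul_one]
  constructor
  · rintro ⟨⟨v, hv⟩, h⟩
    obtain ⟨y, hy⟩ := exists_mul_eq_sq hB hc hv
    rw [← hy, ← mul_assoc, h, mul_assoc]
  · exact fun h => ⟨⟨e ^ 2, sq_mem_satPowers e⟩, h⟩

theorem presheaf_mk_one_mem_add_iff (hB : IsHyperring B) (hc : ∀ a : B, a ^ 3 = a) {e a b c : B} :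
    (Localization.mk a 1 : presheaf e) ∈ Localization.mk b 1 +ₕ Localization.mk c 1 ↔
      a * e ^ 2 ∈ (b * e ^ 2) +ₕ (c * e ^ 2) := by
  rw [mk_mem_add_iff]
  simp only [Submonoid.coe_one, mul_one]
  constructor
  · rintro ⟨⟨v, hv⟩, h⟩
    obtain ⟨y, hy⟩ := exists_mul_eq_sq hB hc hv
    rw [← hy]
    exact mul_mem_add y h (mul_assoc _ _ _) (mul_assoc _ _ _) (mul_assoc _ _ _)
  · exact fun h => ⟨⟨e ^ 2, sq_mem_satPowers e⟩, h⟩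

theorem res_mk_one {a b x : B} (h : D a ⊆ D b) :
    res h (Localization.mk x 1 : presheaf b) = Localization.mk x 1 := rfl

/-- An ideal that contains the members of a cover of `D(e)` contains `e`. -/
theorem mem_of_cover (hc : ∀ a : B, a ^ 3 = a) {e : B} {ι : Type u} {d : ι → B}
    (h : D e = ⋃ i, D (d i)) (I : MIdeal B) (hd : ∀ i, d i ∈ I) : e ∈ I := by
  by_contra he
  obtain ⟨P, hP, hIP, heP⟩ := MIdeal.exists_prime (I := I) (c := e) fun n hn => he (by
    -- All odd powers of `e` equal `e`, so an ideal containing any power of `e` contains `e`.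
    have h1 : e ^ (2 * n + 1) = e := by
      clear hn
      induction n with
      | zero => rw [mul_zero, zero_add, pow_one]
      | succ m ih => rw [show 2 * (m + 1) + 1 = 2 * m + 1 + 2 by omega, pow_add, ih, ← pow_succ', hc]
    rw [← h1, show 2 * n + 1 = (n + 1) + n by omega, pow_add]
    exact I.mul_mem _ _ hn)
  have : (⟨P, hP⟩ : Spec B) ∈ ⋃ i, D (d i) := h ▸ heP
  obtain ⟨i, hi⟩ := Set.mem_iUnion.1 this
  exact hi (hIP (hd i))

end CubePresheaf

/-! ### The real reduced hull of a von Neumann hyperring is geometric -/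

section Geometric

variable {A : Type u} [MultiringStruct A] [IsMultiring A]

namespace RealReducedHull

theorem sq_apply (a : RealReducedHull A) (σ : Sper A) : (a ^ 2).1 σ = a.1 σ * a.1 σ := by
  rw [pow_two, mul_apply]

variable [IsMultiring (RealReducedHull A)]

/-- The complement of the idempotent `a ^ 2`, read at each order: the indicator of the zero set of
`a`. -/
theorem exists_sq_compl (hB : IsHyperring (RealReducedHull A)) (a : RealReducedHull A) :
    ∃ k : RealReducedHull A, ∀ σ : Sper A,
      (a.1 σ ≠ 0 → k.1 σ = 0) ∧ (a.1 σ = 0 → k.1 σ = 1) := by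
  obtain ⟨k, hk, h1⟩ := exists_compl hB (sq_mul_sq_of_cube cube a)
  refine ⟨k, fun σ => ⟨fun ha => ?_, fun ha => ?_⟩⟩
  · have := congrArg (fun x : RealReducedHull A => x.1 σ) hk
    rwa [mul_apply, sq_apply, sign_mul_self_of_ne_zero ha, one_mul, zero_apply] at this
  · have := apply_mem_add h1 σ
    rw [sq_apply, ha, mul_zero, sign_mem_zero_add_iff, one_apply] at this
    exact this.symm

/-- Elements can be patched along the zero set of an element. -/
theorem exists_patch (hB : IsHyperring (RealReducedHull A)) (a y z : RealReducedHull A) :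
    ∃ w : RealReducedHull A, ∀ σ : Sper A,
      (a.1 σ ≠ 0 → w.1 σ = y.1 σ) ∧ (a.1 σ = 0 → w.1 σ = z.1 σ) := by
  obtain ⟨k, hk⟩ := exists_sq_compl hB a
  -- At each order one of the factors `a ^ 2`, `k` is 0 and the other 1, so the sign of `w` is
  -- forced.
  obtain ⟨w, hw⟩ := IsMultiring.add_nonempty (y * a ^ 2) (z * k)
  refine ⟨w, fun σ => ⟨fun ha => ?_, fun ha => ?_⟩⟩
  · have := apply_mem_add hw σ
    rwa [mul_apply, mul_apply, sq_apply, (hk σ).1 ha, sign_mul_self_of_ne_zero ha, mul_one,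
      mul_zero, sign_mem_add_zero_iff] at this
  · have := apply_mem_add hw σ
    rwa [mul_apply, mul_apply, sq_apply, (hk σ).2 ha, ha, mul_zero, mul_zero, mul_one,
      sign_mem_zero_add_iff] at this

/-- Supports of elements of `a + b` lie in the union of the supports; this is why the two sets below
are closed under addition. -/
theorem apply_eq_zero_of_mem_add {a b c : RealReducedHull A} (hc : c ∈ a +ₕ b) {σ : Sper A}
    (ha : a.1 σ = 0) (hb : b.1 σ = 0) : c.1 σ = 0 := by
  have := apply_mem_add hc σ
  rwa [ha, hb, sign_mem_add_zero_iff] at this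

/-- The ideal of the elements on whose supports `x ∈ y + z` holds. -/
def memAddIdeal (hB : IsHyperring (RealReducedHull A)) (x y z : RealReducedHull A) :
    MIdeal (RealReducedHull A) where
  carrier := {a | x * a ^ 2 ∈ (y * a ^ 2) +ₕ (z * a ^ 2)}
  zero_mem := by
    have h : ∀ w : RealReducedHull A, w * 0 ^ 2 = 0 := fun w => by
      rw [pow_two, IsMultiring.mul_zero, IsMultiring.mul_zero]
    change x * 0 ^ 2 ∈ (y * 0 ^ 2) +ₕ (z * 0 ^ 2)
    rw [h, h, h]
    exact self_mem_add_zero 0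
  add_mem := by
    intro a ha b hb c hc
    obtain ⟨k, hk⟩ := exists_sq_compl hB a
    have hb' := mul_mem_add k hb rfl rfl rfl
    -- The relation for `a` is added to that for `b` cut down to the zero set of `a`. By `key`, the
    -- resulting `t, m, n` agree with `x, y, z` on the supports of `a` and `b`, hence on that of
    -- `c`.
    obtain ⟨t, ht⟩ := IsMultiring.add_nonempty (x * a ^ 2) (x * b ^ 2 * k)
    obtain ⟨m, hm, n, hn, htmn⟩ := add_add_add_comm' ht ha hb'
    have key : ∀ x t : RealReducedHull A, t ∈ (x * a ^ 2) +ₕ (x * b ^ 2 * k) →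
        t * c ^ 2 = x * c ^ 2 := by
      intro x t ht
      refine ext fun σ => ?_
      have h := apply_mem_add ht σ
      simp only [mul_apply, sq_apply] at h ⊢
      by_cases ha0 : a.1 σ = 0
      · rw [ha0, mul_zero, mul_zero, (hk σ).2 ha0, mul_one, sign_mem_zero_add_iff] at h
        by_cases hb0 : b.1 σ = 0
        · rw [apply_eq_zero_of_mem_add hc ha0 hb0, mul_zero, mul_zero, mul_zero]
        · rw [h, sign_mul_self_of_ne_zero hb0, mul_one]
      · rw [(hk σ).1 ha0, mul_zero, sign_mem_add_zero_iff, sign_mul_self_of_ne_zero ha0,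
          mul_one] at h
        rw [h]
    exact mul_mem_add (c ^ 2) htmn (key x t ht) (key y m hm) (key z n hn)
  mul_mem := by
    intro a b hb
    refine mul_mem_add (a ^ 2) hb ?_ ?_ ?_ <;> rw [mul_pow] <;> ac_rfl

/-- The ideal of the elements on whose supports the family `x` can be glued. -/
def glueIdeal (hB : IsHyperring (RealReducedHull A)) {ι : Type u} (d x : ι → RealReducedHull A) :
    MIdeal (RealReducedHull A) where
  carrier := {a | ∃ y, ∀ i, y * (d i) ^ 2 * a ^ 2 = x i * (d i) ^ 2 * a ^ 2}
  zero_mem := ⟨0, fun i => by simp only [pow_two, IsMultiring.mul_zero]⟩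
  add_mem := by
    rintro a ⟨y, hy⟩ b ⟨z, hz⟩ c hc
    obtain ⟨w, hw⟩ := exists_patch hB a y z
    refine ⟨w, fun i => ext fun σ => ?_⟩
    have hy := congrArg (fun x : RealReducedHull A => x.1 σ) (hy i)
    have hz := congrArg (fun x : RealReducedHull A => x.1 σ) (hz i)
    simp only [mul_apply, sq_apply] at hy hz ⊢
    by_cases ha0 : a.1 σ = 0
    · by_cases hb0 : b.1 σ = 0
      · rw [apply_eq_zero_of_mem_add hc ha0 hb0, mul_zero, mul_zero, mul_zero]
      · rw [sign_mul_self_of_ne_zero hb0, mul_one, mul_one] at hz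
        rw [(hw σ).2 ha0, hz]
    · rw [sign_mul_self_of_ne_zero ha0, mul_one, mul_one] at hy
      rw [(hw σ).1 ha0, hy]
  mul_mem := by
    rintro a b ⟨y, hy⟩
    exact ⟨y, fun i => by rw [mul_pow, mul_left_comm, hy, mul_left_comm]⟩

theorem isGeometric (hB : IsHyperring (RealReducedHull A)) : IsGeometric (RealReducedHull A) where
  mono := by
    intro e ι d h a b c habc
    obtain ⟨x, rfl⟩ := presheaf_exists_mk_one hB cube a
    obtain ⟨y, rfl⟩ := presheaf_exists_mk_one hB cube b
    obtain ⟨z, rfl⟩ := presheaf_exists_mk_one hB cube c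
    refine (presheaf_mk_one_mem_add_iff hB cube).2
      (mem_of_cover cube h (memAddIdeal hB x y z) fun i => ?_)
    have := habc i
    rw [res_mk_one, res_mk_one, res_mk_one] at this
    exact (presheaf_mk_one_mem_add_iff hB cube).1 this
  glue := by
    intro e ι d h x hx
    choose f hf using fun i => presheaf_exists_mk_one hB cube (x i)
    have hff : ∀ i j, f j * d i ^ 2 * d j ^ 2 = f i * d i ^ 2 * d j ^ 2 := fun i j => by
      have := hx i j
      rw [hf i, hf j, res_mk_one, res_mk_one, presheaf_mk_one_eq_iff hB cube, mul_pow] at this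
      rw [mul_assoc, mul_assoc, this]
    -- Compatibility on `D (d i * d j)` says that `f j` itself glues the family over the support of
    -- `d j`, so each `d j` lies in the ideal.
    obtain ⟨y, hy⟩ : e ∈ glueIdeal hB d f :=
      mem_of_cover cube h _ fun j => ⟨f j, fun i => hff i j⟩
    refine ⟨Localization.mk y 1, fun i => ?_⟩
    rw [hf i, res_mk_one, presheaf_mk_one_eq_iff hB cube]
    -- As `D (d i) ⊆ D e`, the element `d i ^ 2` is a multiple of `e ^ 2`; multiplying by the
    -- cofactor `t` trades `e ^ 2` for `d i ^ 2`.
    obtain ⟨t, ht⟩ := exists_mul_eq_sq hB cube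
      (satPowers_le_of_D_subset (D_subset_of_cover h i) (sq_mem_satPowers e))
    have hyt := congrArg (· * t) (hy i)
    rwa [mul_assoc, mul_assoc (f i * _), ht, mul_assoc, mul_assoc (f i),
      sq_mul_sq_of_cube cube] at hyt

end RealReducedHull

theorem realReducedHull_isGeometric (hA : IsVonNeumannHyperring A) :
    IsGeometricVonNeumannHyperring (RealReducedHull A) where
  toIsVonNeumannHyperring := realReducedHull_isVonNeumannHyperring hA
  geometric :=
    have := (realReducedHull_isVonNeumannHyperring hA).toIsHyperring
    RealReducedHull.isGeometric this

end Geometric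

end Multiring

theorem mainTheorem12 {A : Type u} [MultiringStruct A] [Multiring.IsMultiring A] :
    (Multiring.IsRealReducedMultiring A →
      Multiring.IsRealReducedMultiring (Multiring.VonNeumannHull A)) ∧
    (Multiring.IsVonNeumannHyperring A →
      Multiring.IsGeometricVonNeumannHyperring (Multiring.RealReducedHull A)) :=
  ⟨Multiring.vonNeumannHull_isRealReduced, Multiring.realReducedHull_isGeometric⟩
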